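/- For a graph $G$, a vertex $v$ and an integer $r\ge 1$, let $N_r(v)$ be the subgraph of $G$ induced by the vertices at distance at most $r$ from $v$, with $v$ as distinguished vertex. Call $G$ *reconstructible from its $r$-neighbourhoods* if every graph $H$ for which there are a bijection $\phi:V(G)\to V(H)$ and, for each $v\in V(G)$, a graph isomorphism from $N_r(v)$ in $G$ to $N_r(\phi(v))$ in $H$ mapping $v$ to $\phi(v)$, is isomorphic to $G$. Let $\mathcal G(n,p)$ be the random graph on $n$ vertices in which each pair of vertices is an edge independently with probability $p$. **Theorem.** There exists a constant $\delta>0$ such that for every sequence $p=p(n)\in[0,1]$ with $p(n)\ge n^{-2/3-\delta}$ for all sufficiently large $n$, the random graph $G\in\mathcal G(n,p(n))$ is reconstructible from its $2$-neighbourhoods with high probability, i.e. with probability tending to $1$ as $n\to\infty$. -/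

import Mathlib

open Filter Topology
open scoped SimpleGraph

namespace Shotgun

/-- The set of vertices of `G` at (graph) distance at most `r` from `v`. The extended distance is
used, so vertices in other components are at distance `⊤` and do not belong to the ball. -/
def ballSet {V : Type*} (G : SimpleGraph V) (r : ℕ) (v : V) : Set V :=
  {w | G.edist v w ≤ (r : ℕ∞)}

/-- The `r`-neighbourhood `N_r(v)`: the subgraph of `G` induced by the vertices at distance at most
`r` from `v`. -/
abbrev nbhd {V : Type*} (G : SimpleGraph V) (r : ℕ) (v : V) : SimpleGraph (ballSet G r v) :=
  G.induce (ballSet G r v)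

/-- The distinguished vertex `v` of the `r`-neighbourhood around `v`. -/
def center {V : Type*} (G : SimpleGraph V) (r : ℕ) (v : V) : ballSet G r v :=
  ⟨v, by simp [ballSet]⟩

/-- `G` and `H` have isomorphic `r`-neighbourhoods: there is a bijection `φ : V(G) → V(H)` such that
for every vertex `v` of `G` there is a graph isomorphism `N_r(v) ≃ N_r(φ v)` mapping `v` to
`φ v`. -/
def HaveIsomorphicNbhds {V W : Type*} (r : ℕ) (G : SimpleGraph V) (H : SimpleGraph W) : Prop :=
  ∃ φ : V ≃ W, ∀ v : V, ∃ e : nbhd G r v ≃g nbhd H r (φ v), e (center G r v) = center H r (φ v)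

/-- `G` is reconstructible from its `r`-neighbourhoods: every graph `H`, on any vertex set, with
`r`-neighbourhoods isomorphic to those of `G` is isomorphic to `G`. -/
def IsReconstructible.{u} {V : Type u} (r : ℕ) (G : SimpleGraph V) : Prop :=
  ∀ (W : Type u) (H : SimpleGraph W), HaveIsomorphicNbhds r G H → Nonempty (G ≃g H)

end Shotgun

namespace Shotgun

/-! Reconstruction rests on an invariant of oriented edges. For an edge `uv`, `profile j G u v`
records how many neighbours of `u` have exactly `k` neighbours in the first (`j = false`) or second
(`j = true`) neighbourhood of `v`. Both the 2-ball of `u` and the 2-ball of `v` determine it. If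
oriented edges with different tails never share a profile (apart from a reversal case that symmetry
removes), each local isomorphism `e v` must agree with `φ` on the neighbours of `v`, so `φ` is
itself an isomorphism (`isReconstructible_of_profile`).

To see that two edges `uv`, `u'v'` rarely collide, choose a set `A` of neighbours of `u` and a set
`X` inside the target of `v`, so that the edges between `A` and `X` affect the profile of `uv` in a
controlled way and leave that of `u'v'` alone. Neither choice looks at those edges, so they can be
resampled without changing the law of `G` (`binomialRandom_real_eq_resample`). The vertices of `A`
are chosen to have equally many neighbours in the target outside `X`. A collision then prescribes,
for every `l`, how many of `|A|` independent random subsets of `X` have size `l`. With `|X|p` about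
`n ^ (-η)`, Fourier analysis on `(ℤ/M)^K` bounds the probability of this by the `K`-th power of a
small negative power of `n` (`sum_choices_card_eq_le`). A large constant `K` gives `n ^ (-6)`, which
beats the union bound over `n ^ 4` pairs of edges.

It remains to find room for `X`, of size about `n ^ (-η) / p`. Well above `p = n ^ (-1/2)` the
diameter is at most two and a single 2-ball is the whole graph. Near `n ^ (-1/2)` the first
neighbourhood, of size about `np`, is large enough. Below that the second neighbourhood has size
about `(np)^2`, and `(np)^2 ≥ n ^ (-η) / p` up to smaller factors means `p ≥ n ^ (-2/3 - δ)` for a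
small `δ`: this is the source of the exponent. Degrees, codegrees and intersections with second
neighbourhoods are controlled by Chernoff bounds, obtained from the same resampling principle. -/

/-- The vertices joined to `v` by a walk of length `1` (for `false`) or `2` (for `true`). -/
def target {V : Type*} : Bool → SimpleGraph V → V → Set V
  | false, G, v => {x | G.Adj v x}
  | true, G, v => {x | ∃ b, G.Adj v b ∧ G.Adj b x}

/-- The number of neighbours of `u` with exactly `k` neighbours in `target j G v`. -/
noncomputable def profile {V : Type*} (j : Bool) (G : SimpleGraph V) (u v : V) (k : ℕ) : ℕ :=
  {a | G.Adj u a ∧ {x | G.Adj a x ∧ x ∈ target j G v}.ncard = k}.ncard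

/-! ### Profiles of oriented edges and deterministic reconstruction. -/

section Deterministic

variable {V W : Type*} {G : SimpleGraph V} {H : SimpleGraph W}

lemma mem_target_iso (j : Bool) (e : G ≃g H) (v x : V) :
    e x ∈ target j H (e v) ↔ x ∈ target j G v := by
  cases j
  · exact e.map_adj_iff
  · simp only [target, Set.mem_ofPred_eq]
    constructor
    · rintro ⟨b, h1, h2⟩
      obtain ⟨b, rfl⟩ := e.surjective b
      exact ⟨b, e.map_adj_iff.1 h1, e.map_adj_iff.1 h2⟩
    · rintro ⟨b, h1, h2⟩
      exact ⟨e b, e.map_adj_iff.2 h1, e.map_adj_iff.2 h2⟩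

lemma profile_iso (j : Bool) (e : G ≃g H) (u v : V) (k : ℕ) :
    profile j H (e u) (e v) k = profile j G u v k := by
  have inner (a : V) : {x | H.Adj (e a) x ∧ x ∈ target j H (e v)}.ncard
      = {x | G.Adj a x ∧ x ∈ target j G v}.ncard := by
    rw [← Set.ncard_image_of_injective _ e.injective]
    congr 1
    ext y
    obtain ⟨x, rfl⟩ := e.surjective y
    simp [mem_target_iso, show H.Adj (e a) (e x) ↔ G.Adj a x from e.map_adj_iff]
  unfold profile
  rw [← Set.ncard_image_of_injective {a | G.Adj u a ∧ _} e.injective]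
  congr 1
  ext y
  obtain ⟨a, rfl⟩ := e.surjective y
  simp [inner, show H.Adj (e u) (e a) ↔ G.Adj u a from e.map_adj_iff]

/-- The hypotheses put into `s` everything that the count inspects, including the middle vertices of
the walks of length two from `v`. For adjacent `u` and `v` the 2-ball of either end qualifies. -/
lemma profile_induce (j : Bool) (s : Set V) (u v : s) (k : ℕ)
    (hu : ∀ a, G.Adj u a → a ∈ s) (hv : ∀ a, G.Adj v a → a ∈ s)
    (hx : ∀ a x, G.Adj u a → G.Adj a x → x ∈ target j G v → x ∈ s) :
    profile j (G.induce s) u v k = profile j G u v k := by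
  have htarget (x : s) : x ∈ target j (G.induce s) v ↔ (x : V) ∈ target j G v := by
    cases j
    · simp [target]
    · simp only [target, Set.mem_ofPred_eq]
      constructor
      · rintro ⟨b, h1, h2⟩
        exact ⟨b, h1, h2⟩
      · rintro ⟨b, h1, h2⟩
        exact ⟨⟨b, hv b h1⟩, h1, h2⟩
  have inner (a : s) (ha : G.Adj u a) : {x | (G.induce s).Adj a x ∧ x ∈ target j (G.induce s) v}.ncard
      = {x | G.Adj a x ∧ x ∈ target j G v}.ncard := by
    rw [← Set.ncard_image_of_injective _ Subtype.val_injective]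
    congr 1
    ext y
    simp only [Set.mem_image, Set.mem_ofPred_eq, htarget]
    constructor
    · rintro ⟨x, ⟨h1, h2⟩, rfl⟩
      exact ⟨h1, h2⟩
    · rintro ⟨h1, h2⟩
      exact ⟨⟨y, hx _ _ ha h1 h2⟩, ⟨h1, h2⟩, rfl⟩
  unfold profile
  rw [← Set.ncard_image_of_injective _ Subtype.val_injective]
  congr 1
  ext y
  simp only [Set.mem_image, Set.mem_ofPred_eq]
  constructor
  · rintro ⟨a, ⟨h1, h2⟩, rfl⟩
    exact ⟨h1, (inner a h1) ▸ h2⟩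
  · rintro ⟨h1, h2⟩
    exact ⟨⟨y, hu _ h1⟩, ⟨h1, (inner ⟨y, hu _ h1⟩ h1).trans h2⟩, rfl⟩

lemma mem_ballSet_of_adj {v a : V} (h : G.Adj v a) : a ∈ ballSet G 2 v := by
  show G.edist v a ≤ _
  rw [SimpleGraph.edist_eq_one_iff_adj.2 h]
  norm_num

lemma mem_ballSet_of_adj_adj {v a b : V} (h : G.Adj v a) (h' : G.Adj a b) : b ∈ ballSet G 2 v :=
  (SimpleGraph.edist_le (.cons h (.cons h' .nil))).trans (by simp)

lemma mem_ballSet_of_mem_target {j : Bool} {v x : V} (h : x ∈ target j G v) :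
    x ∈ ballSet G 2 v := by
  cases j
  · exact mem_ballSet_of_adj h
  · obtain ⟨b, h1, h2⟩ := h
    exact mem_ballSet_of_adj_adj h1 h2

lemma profile_nbhd_right (j : Bool) {v : V} (u : ballSet G 2 v) (h : G.Adj v u) (k : ℕ) :
    profile j (nbhd G 2 v) u (center G 2 v) k = profile j G u v k :=
  profile_induce j _ u (center G 2 v) k (fun _ ha => mem_ballSet_of_adj_adj h ha)
    (fun _ ha => mem_ballSet_of_adj ha) (fun _ _ _ _ hx => mem_ballSet_of_mem_target hx)

lemma profile_nbhd_left (j : Bool) {u : V} (v : ballSet G 2 u) (h : G.Adj u v) (k : ℕ) :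
    profile j (nbhd G 2 u) (center G 2 u) v k = profile j G u v k :=
  profile_induce j _ (center G 2 u) v k (fun _ ha => mem_ballSet_of_adj ha)
    (fun _ ha => mem_ballSet_of_adj_adj h ha) (fun _ _ ha hx _ => mem_ballSet_of_adj_adj ha hx)

/-- If `e v` sends a neighbour `u` of `v` to `φ u''`, pulling the edge between `φ u''` and `φ v`
back through `e u''` gives an edge of `G` at `u''`. Its profile equals that of `(u, v)`, because
both are read off the same oriented edge of `H`. Separation of profiles then forces `u'' = u`. -/
theorem isReconstructible_of_profile {V : Type*} {G : SimpleGraph V} (j : Bool)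
    (hG : ∀ u v u' v', G.Adj u v → G.Adj u' v' → u ≠ u' → u ≠ v' →
      ∃ k, profile j G u v k ≠ profile j G u' v' k) :
    IsReconstructible 2 G := by
  rintro W H ⟨φ, hφ⟩
  choose e he using hφ
  have hadj (v : V) (a : ballSet G 2 v) : H.Adj (φ v) (e v a) ↔ G.Adj v a := by
    have := (e v).map_adj_iff (v := center G 2 v) (w := a)
    rw [he] at this
    exact this
  have key (v : V) (u : ballSet G 2 v) (huv : G.Adj v u) : (e v u : W) = φ u := by
    have h1 := (hadj v u).2 huv
    let w : W := e v u
    obtain ⟨u'', hu''⟩ := φ.surjective w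
    have hadjH : H.Adj (φ u'') (φ v) := by
      rw [hu'']
      exact h1.symm
    have hmem : φ v ∈ ballSet H 2 (φ u'') := mem_ballSet_of_adj hadjH
    set v'' := (e u'').symm ⟨φ v, hmem⟩ with hv''
    have hev : e u'' v'' = ⟨φ v, hmem⟩ := by simp [hv'']
    have hadj'' : G.Adj u'' v'' := by
      rw [← hadj u'' v'', hev]
      exact hadjH
    have hprof (k : ℕ) : profile j G u v k = profile j G u'' v'' k := by
      rw [← profile_nbhd_right j u huv, ← profile_nbhd_left j v'' hadj'',
        ← profile_iso j (e v), ← profile_iso j (e u''), he, he,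
        profile_nbhd_right j (e v u) h1, hev,
        profile_nbhd_left j ⟨φ v, hmem⟩ hadjH]
      show profile j H w (φ v) k = profile j H (φ u'') (φ v) k
      rw [hu'']
    have hne : u'' ≠ v := by
      rintro rfl
      exact h1.ne hu''
    by_contra hcon
    have hne' : (u : V) ≠ u'' := by
      rintro h
      exact hcon (by rw [h, hu''])
    -- The hypothesis does not cover a second edge whose head is `u`. In that case compare the edges
    -- in the opposite order: the tail `u''` is neither `u` nor `v`.
    by_cases huv'' : (u : V) = v''
    · obtain ⟨k, hk⟩ := hG u'' v'' u v hadj'' huv.symm hne'.symm hne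
      exact hk (hprof k).symm
    · obtain ⟨k, hk⟩ := hG u v u'' v'' huv.symm hadj'' hne' huv''
      exact hk (hprof k)
  refine ⟨⟨φ, ?_⟩⟩
  intro v u
  constructor
  · intro h
    set a := (e v).symm ⟨φ u, mem_ballSet_of_adj h⟩ with ha
    have hea : e v a = ⟨φ u, mem_ballSet_of_adj h⟩ := by simp [ha]
    have hva : G.Adj v a := by
      rw [← hadj, hea]
      exact h
    have := key v a hva
    rw [hea] at this
    rw [φ.injective this]
    exact hva
  · intro h
    have := (hadj v ⟨u, mem_ballSet_of_adj h⟩).2 h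
    rwa [key v _ h] at this

/-- The 2-ball of `v` is then all of `G`. By cardinality the corresponding ball of `H` is all of
`H`, so one local isomorphism is already global. -/
theorem isReconstructible_of_ballSet_eq_univ {V : Type*} [Finite V] {G : SimpleGraph V} (v : V)
    (hG : ∀ w, w ∈ ballSet G 2 v) : IsReconstructible 2 G := by
  rintro W H ⟨φ, hφ⟩
  obtain ⟨e, -⟩ := hφ v
  have : Finite W := .of_equiv V φ
  have hH : ballSet H 2 (φ v) = Set.univ := by
    refine Set.eq_of_subset_of_ncard_le (Set.subset_univ _) (le_of_eq ?_)
    rw [← Nat.card_coe_set_eq (ballSet H 2 (φ v)), ← Nat.card_congr e.toEquiv,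
      Nat.card_coe_set_eq, Set.eq_univ_of_forall hG, Set.ncard_univ, Set.ncard_univ,
      Nat.card_congr φ]
  refine ⟨⟨(Equiv.subtypeUnivEquiv hG).symm.trans (e.toEquiv.trans
    (Equiv.subtypeUnivEquiv (fun w => hH ▸ Set.mem_univ w))), ?_⟩⟩
  intro a b
  exact e.map_adj_iff (v := ⟨a, hG a⟩) (w := ⟨b, hG b⟩)

end Deterministic
-- Resampling the edges between two sets that depend on the graph.
section Resampling
open MeasureTheory
open scoped Classical

set_option linter.unusedSectionVars false

variable {V : Type*} [Fintype V]

lemma measurableSet_singleton_graph (G : SimpleGraph V) : MeasurableSet {G} := by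
  have : ({G} : Set (SimpleGraph V)) = SimpleGraph.edgeSet ⁻¹' {G.edgeSet} := by
    ext H
    simp
  rw [this]
  exact SimpleGraph.measurable_edgeSet (measurableSet_singleton _)

/-- The probability of the graph `G` under the binomial distribution. -/
noncomputable def weight (p : ℝ) (G : SimpleGraph V) : ℝ :=
  p ^ G.edgeSet.ncard * (1 - p) ^ ((Fintype.card V).choose 2 - G.edgeSet.ncard)

lemma weight_nonneg (p : unitInterval) (G : SimpleGraph V) : 0 ≤ weight (p : ℝ) G :=
  mul_nonneg (pow_nonneg p.2.1 _) (pow_nonneg (sub_nonneg.2 p.2.2) _)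

lemma binomialRandom_real_eq_sum (p : unitInterval) (S : Set (SimpleGraph V)) :
    (SimpleGraph.binomialRandom V p).real S = ∑ G, if G ∈ S then weight (p : ℝ) G else 0 := by
  have h : S = ⋃ G ∈ Finset.univ.filter (· ∈ S), {G} := by ext; simp
  rw [← Finset.sum_filter]
  conv_lhs => rw [h]
  rw [measureReal_biUnion_finset]
  · refine Finset.sum_congr rfl fun G _ => ?_
    simp [Measure.real, weight, Nat.card_eq_fintype_card]
  · intro G _ H _ hne
    simpa using hne
  · intro G _
    exact measurableSet_singleton_graph G

lemma sum_weight (p : unitInterval) : ∑ G : SimpleGraph V, weight (p : ℝ) G = 1 := by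
  have := binomialRandom_real_eq_sum (V := V) p Set.univ
  simpa using this.symm

/-- Replace the edges of `G` between `A` and `X` by those joining each `a ∈ A` to `f a`. -/
def rewire (G : SimpleGraph V) (A X : Finset V) (f : V → Finset V) : SimpleGraph V where
  Adj x y := x ≠ y ∧ ((x ∈ A ∧ y ∈ X ∧ y ∈ f x) ∨ (y ∈ A ∧ x ∈ X ∧ x ∈ f y) ∨
    (G.Adj x y ∧ ¬ (x ∈ A ∧ y ∈ X) ∧ ¬ (y ∈ A ∧ x ∈ X)))
  symm := ⟨by
    rintro x y ⟨hne, h⟩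
    refine ⟨hne.symm, ?_⟩
    rw [G.adj_comm]
    tauto⟩
  loopless := ⟨fun x h => h.1 rfl⟩

/-- The possible choices of the edges between `A` and `X`. -/
noncomputable def choices (A X : Finset V) : Finset (V → Finset V) :=
  Fintype.piFinset fun a => if a ∈ A then X.powerset else {∅}

lemma mem_choices {A X : Finset V} {f : V → Finset V} :
    f ∈ choices A X ↔ (∀ a ∈ A, f a ⊆ X) ∧ ∀ a ∉ A, f a = ∅ := by
  simp only [choices, Fintype.mem_piFinset]
  constructor
  · intro h
    exact ⟨fun a ha => by simpa [ha] using h a, fun a ha => by simpa [ha] using h a⟩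
  · rintro ⟨h1, h2⟩ a
    by_cases ha : a ∈ A
    · simpa [ha] using h1 a ha
    · simpa [ha] using h2 a ha

/-- The edges of `G` between `A` and `X`. -/
noncomputable def trace (G : SimpleGraph V) (A X : Finset V) : V → Finset V :=
  fun a => if a ∈ A then {x ∈ X | G.Adj a x} else ∅

/-- The probability that a random subset of `X` equals `T`. -/
noncomputable def subsetWeight (p : ℝ) (X T : Finset V) : ℝ :=
  p ^ T.card * (1 - p) ^ (X.card - T.card)

lemma trace_mem_choices (G : SimpleGraph V) (A X : Finset V) : trace G A X ∈ choices A X := by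
  rw [mem_choices]
  constructor <;> intro a ha <;> simp [trace, ha]

lemma rewire_adj_of_mem {G : SimpleGraph V} {A X : Finset V} (hd : Disjoint A X)
    {f : V → Finset V} {a x : V} (ha : a ∈ A) (hx : x ∈ X) :
    (rewire G A X f).Adj a x ↔ x ∈ f a := by
  have h1 : x ∉ A := fun h => Finset.disjoint_left.1 hd h hx
  have h2 : a ≠ x := by
    rintro rfl
    exact h1 ha
  simp [rewire, ha, hx, h1, h2]

lemma rewire_adj_of_not {G : SimpleGraph V} {A X : Finset V}
    {f : V → Finset V} {x y : V} (h1 : ¬ (x ∈ A ∧ y ∈ X)) (h2 : ¬ (y ∈ A ∧ x ∈ X)) :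
    (rewire G A X f).Adj x y ↔ G.Adj x y := by
  have := fun h : G.Adj x y => h.ne
  simp only [rewire]
  tauto

lemma trace_rewire {G : SimpleGraph V} {A X : Finset V} (hd : Disjoint A X) {f : V → Finset V}
    (hf : f ∈ choices A X) : trace (rewire G A X f) A X = f := by
  rw [mem_choices] at hf
  funext a
  by_cases ha : a ∈ A
  · ext x
    simp only [trace, ha, if_true, Finset.mem_filter]
    constructor
    · rintro ⟨hx, h⟩
      exact (rewire_adj_of_mem hd ha hx).1 h
    · intro h
      have hx := hf.1 a ha h
      exact ⟨hx, (rewire_adj_of_mem hd ha hx).2 h⟩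
  · simp [trace, ha, hf.2 a ha]

lemma rewire_rewire_trace (G : SimpleGraph V) {A X : Finset V} (hd : Disjoint A X)
    (f : V → Finset V) : rewire (rewire G A X f) A X (trace G A X) = G := by
  ext x y
  by_cases h1 : x ∈ A ∧ y ∈ X
  · rw [rewire_adj_of_mem hd h1.1 h1.2]
    simp [trace, h1.1, h1.2]
  by_cases h2 : y ∈ A ∧ x ∈ X
  · rw [SimpleGraph.adj_comm, rewire_adj_of_mem hd h2.1 h2.2, G.adj_comm]
    simp [trace, h2.1, h2.2]
  rw [rewire_adj_of_not h1 h2, rewire_adj_of_not h1 h2]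

lemma ncard_edgeSet_rewire (G : SimpleGraph V) {A X : Finset V} (hd : Disjoint A X)
    {f : V → Finset V} (hf : f ∈ choices A X) :
    (rewire G A X f).edgeSet.ncard
      = (rewire G A X fun _ => ∅).edgeSet.ncard + ∑ a ∈ A, (f a).card := by
  rw [mem_choices] at hf
  have hfX : ∀ a ∈ A, ∀ x ∈ f a, x ∈ X ∧ x ∉ A ∧ a ∉ X := fun a ha x hx =>
    ⟨hf.1 a ha hx, fun h => Finset.disjoint_left.1 hd h (hf.1 a ha hx),
      Finset.disjoint_left.1 hd ha⟩
  have hunion : (rewire G A X f).edgeSet = (rewire G A X fun _ => ∅).edgeSet ∪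
      ((A.sigma f).image fun q => s(q.1, q.2) : Finset (Sym2 V)) := by
    ext e
    induction e with
    | h x y =>
      simp only [SimpleGraph.mem_edgeSet, Set.mem_union, Finset.coe_image, Set.mem_image,
        Finset.mem_coe, Finset.mem_sigma, Sigma.exists]
      by_cases h1 : x ∈ A ∧ y ∈ X
      · rw [rewire_adj_of_mem hd h1.1 h1.2, rewire_adj_of_mem hd h1.1 h1.2]
        constructor
        · exact fun h => .inr ⟨x, y, ⟨h1.1, h⟩, rfl⟩
        · rintro (h | ⟨a, b, ⟨ha, hb⟩, h⟩)
          · simp at h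
          · rw [Sym2.eq_iff] at h
            rcases h with ⟨rfl, rfl⟩ | ⟨rfl, rfl⟩
            · exact hb
            · exact absurd h1.1 (hfX _ ha _ hb).2.1
      by_cases h2 : y ∈ A ∧ x ∈ X
      · rw [SimpleGraph.adj_comm, rewire_adj_of_mem hd h2.1 h2.2, SimpleGraph.adj_comm,
          rewire_adj_of_mem hd h2.1 h2.2]
        constructor
        · exact fun h => .inr ⟨y, x, ⟨h2.1, h⟩, Sym2.eq_swap⟩
        · rintro (h | ⟨a, b, ⟨ha, hb⟩, h⟩)
          · simp at h
          · rw [Sym2.eq_iff] at h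
            rcases h with ⟨rfl, rfl⟩ | ⟨rfl, rfl⟩
            · exact absurd h2.1 (hfX _ ha _ hb).2.1
            · exact hb
      rw [rewire_adj_of_not h1 h2, rewire_adj_of_not h1 h2]
      constructor
      · exact .inl
      · rintro (h | ⟨a, b, ⟨ha, hb⟩, h⟩)
        · exact h
        · rw [Sym2.eq_iff] at h
          rcases h with ⟨rfl, rfl⟩ | ⟨rfl, rfl⟩
          · exact absurd ⟨ha, (hfX _ ha _ hb).1⟩ h1
          · exact absurd ⟨ha, (hfX _ ha _ hb).1⟩ h2
  rw [hunion, Set.ncard_union_eq]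
  · rw [Set.ncard_coe_finset, Finset.card_image_of_injOn, Finset.card_sigma]
    rintro ⟨a, b⟩ hab ⟨c, d⟩ hcd h
    simp only [Finset.coe_sigma, Set.mem_sigma_iff, Finset.mem_coe] at hab hcd
    simp only [Sym2.eq_iff] at h
    rcases h with ⟨rfl, rfl⟩ | ⟨rfl, rfl⟩
    · rfl
    · exact absurd hcd.1 (hfX _ hab.1 _ hab.2).2.1
  · rw [Set.disjoint_left]
    intro e he h
    simp only [Finset.coe_image, Set.mem_image, Finset.mem_coe, Finset.mem_sigma,
      Sigma.exists] at h
    obtain ⟨a, b, ⟨ha, hb⟩, rfl⟩ := h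
    rw [SimpleGraph.mem_edgeSet, rewire_adj_of_mem hd ha (hfX _ ha _ hb).1] at he
    simp at he

lemma ncard_edgeSet_le (G : SimpleGraph V) : G.edgeSet.ncard ≤ (Fintype.card V).choose 2 := by
  rw [← G.coe_edgeFinset, Set.ncard_coe_finset]
  exact G.card_edgeFinset_le_card_choose_two

lemma prod_subsetWeight {A X : Finset V} {f : V → Finset V} (p : ℝ) :
    ∏ a ∈ A, subsetWeight p X (f a)
      = p ^ (∑ a ∈ A, (f a).card) * (1 - p) ^ (∑ a ∈ A, (X.card - (f a).card)) := by
  simp only [subsetWeight, Finset.prod_mul_distrib, Finset.prod_pow_eq_pow_sum]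

/-- Detailed balance for the exchange of `f` with the current `A`–`X` edges: both sides carry the
same total exponents of `p` and of `1 - p`. -/
lemma weight_rewire_mul (p : ℝ) (G : SimpleGraph V) {A X : Finset V} (hd : Disjoint A X)
    {f : V → Finset V} (hf : f ∈ choices A X) :
    weight p G * ∏ a ∈ A, subsetWeight p X (f a)
      = weight p (rewire G A X f) * ∏ a ∈ A, subsetWeight p X (trace G A X a) := by
  have h1 := ncard_edgeSet_rewire G hd hf
  have h2 := ncard_edgeSet_rewire (rewire G A X f) hd (trace_mem_choices G A X)
  have h3 := ncard_edgeSet_rewire G hd (f := fun _ => ∅) (mem_choices.2 (by simp))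
  have h4 : rewire (rewire G A X f) A X (fun _ => ∅) = rewire G A X (fun _ => ∅) := by
    ext x y
    by_cases h1 : x ∈ A ∧ y ∈ X
    · rw [rewire_adj_of_mem hd h1.1 h1.2, rewire_adj_of_mem hd h1.1 h1.2]
    by_cases h2 : y ∈ A ∧ x ∈ X
    · rw [SimpleGraph.adj_comm, rewire_adj_of_mem hd h2.1 h2.2, SimpleGraph.adj_comm,
        rewire_adj_of_mem hd h2.1 h2.2]
    rw [rewire_adj_of_not h1 h2, rewire_adj_of_not h1 h2, rewire_adj_of_not h1 h2]
  rw [rewire_rewire_trace G hd, h4] at h2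
  have hsum {g : V → Finset V} (hg : g ∈ choices A X) :
      ∑ a ∈ A, (X.card - (g a).card) + ∑ a ∈ A, (g a).card = A.card * X.card := by
    rw [← Finset.sum_add_distrib, Finset.sum_const_nat]
    intro a ha
    have := Finset.card_le_card ((mem_choices.1 hg).1 a ha)
    omega
  have h5 := hsum hf
  have h6 := hsum (trace_mem_choices G A X)
  have h7 := ncard_edgeSet_le G
  have h8 := ncard_edgeSet_le (rewire G A X f)
  rw [prod_subsetWeight, prod_subsetWeight, weight, weight]
  generalize (rewire G A X f).edgeSet.ncard = e' at *
  generalize G.edgeSet.ncard = e at *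
  generalize (rewire G A X fun _ => ∅).edgeSet.ncard = e₀ at *
  generalize ∑ a ∈ A, (trace G A X a).card = s' at *
  generalize ∑ a ∈ A, (f a).card = s at *
  generalize ∑ a ∈ A, (X.card - (f a).card) = r at *
  generalize ∑ a ∈ A, (X.card - (trace G A X a).card) = r' at *
  generalize (Fintype.card V).choose 2 = M at *
  generalize A.card * X.card = L at *
  rw [mul_mul_mul_comm (p ^ e), mul_mul_mul_comm (p ^ e'), ← pow_add, ← pow_add, ← pow_add, ← pow_add]
  congr 2 <;> omega

lemma sum_subsetWeight (p : ℝ) (X : Finset V) :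
    ∑ T ∈ X.powerset, subsetWeight p X T = 1 := by
  simp only [subsetWeight]
  rw [Finset.sum_pow_mul_eq_add_pow]
  simp

lemma sum_choices_prod {R : Type*} [CommSemiring R] (A X : Finset V) (g : Finset V → R) :
    ∑ f ∈ choices A X, ∏ a ∈ A, g (f a) = (∑ T ∈ X.powerset, g T) ^ A.card := by
  have := Finset.prod_univ_sum (fun a => if a ∈ A then X.powerset else {∅})
    (fun a T => if a ∈ A then g T else 1)
  rw [choices]
  have h2 : ∀ f : V → Finset V, ∏ a ∈ A, g (f a) = ∏ a, if a ∈ A then g (f a) else 1 := by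
    intro f
    rw [Finset.prod_ite_mem]
    simp
  simp_rw [h2]
  rw [← this, ← Finset.prod_const]
  rw [← Finset.prod_subset (Finset.subset_univ A)]
  · exact Finset.prod_congr rfl fun a ha => by simp [ha]
  · intro a _ ha
    simp [ha]

/-- Resampling the edges between two random disjoint sets, chosen without looking at the edges
between them, does not change the distribution of the binomial random graph. -/
theorem binomialRandom_real_eq_resample (p : unitInterval) (A X : SimpleGraph V → Finset V)
    (hd : ∀ G, Disjoint (A G) (X G))
    (hA : ∀ G, ∀ f ∈ choices (A G) (X G), A (rewire G (A G) (X G) f) = A G)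
    (hX : ∀ G, ∀ f ∈ choices (A G) (X G), X (rewire G (A G) (X G) f) = X G)
    (S : Set (SimpleGraph V)) :
    (SimpleGraph.binomialRandom V p).real S = ∑ G, weight (p : ℝ) G *
      ∑ f ∈ choices (A G) (X G), if rewire G (A G) (X G) f ∈ S
        then ∏ a ∈ A G, subsetWeight (p : ℝ) (X G) (f a) else 0 := by
  rw [binomialRandom_real_eq_sum]
  have h1 (G : SimpleGraph V) : (if G ∈ S then weight (p : ℝ) G else 0)
      = ∑ f ∈ choices (A G) (X G), if G ∈ S
        then weight (p : ℝ) G * ∏ a ∈ A G, subsetWeight (p : ℝ) (X G) (f a) else 0 := by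
    split_ifs
    · rw [← Finset.mul_sum, sum_choices_prod, sum_subsetWeight, one_pow, mul_one]
    · simp
  simp_rw [h1, Finset.mul_sum, mul_ite, mul_zero]
  rw [Finset.sum_sigma', Finset.sum_sigma']
  -- Swapping the sampled edges with the present ones is an involution on pairs `(G, f)`. It is well
  -- defined since `A` and `X` survive rewiring, and it preserves the product weight.
  refine Finset.sum_nbij' (fun q => ⟨rewire q.1 (A q.1) (X q.1) q.2, trace q.1 (A q.1) (X q.1)⟩)
    (fun q => ⟨rewire q.1 (A q.1) (X q.1) q.2, trace q.1 (A q.1) (X q.1)⟩) ?_ ?_ ?_ ?_ ?_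
  iterate 2
    rintro ⟨G, f⟩ hf
    simp only [Finset.mem_sigma, Finset.mem_univ, true_and] at hf ⊢
    rw [hA G f hf, hX G f hf]
    exact trace_mem_choices _ _ _
  iterate 2
    rintro ⟨G, f⟩ hf
    simp only [Finset.mem_sigma, Finset.mem_univ, true_and] at hf ⊢
    rw [hA G f hf, hX G f hf, rewire_rewire_trace G (hd G), trace_rewire (hd G) hf]
  · rintro ⟨G, f⟩ hf
    simp only [Finset.mem_sigma, Finset.mem_univ, true_and] at hf ⊢
    rw [hA G f hf, hX G f hf, rewire_rewire_trace G (hd G), weight_rewire_mul _ G (hd G) hf]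

/-- A bound on the conditional probability, uniform over everything except the `A`–`X` edges, is a
bound on the probability. -/
theorem binomialRandom_real_le_of_resample (p : unitInterval) (A X : SimpleGraph V → Finset V)
    (hd : ∀ G, Disjoint (A G) (X G))
    (hA : ∀ G, ∀ f ∈ choices (A G) (X G), A (rewire G (A G) (X G) f) = A G)
    (hX : ∀ G, ∀ f ∈ choices (A G) (X G), X (rewire G (A G) (X G) f) = X G)
    (S : Set (SimpleGraph V)) (ε : ℝ)
    (h : ∀ G, ∑ f ∈ choices (A G) (X G), (if rewire G (A G) (X G) f ∈ S
        then ∏ a ∈ A G, subsetWeight (p : ℝ) (X G) (f a) else 0) ≤ ε) :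
    (SimpleGraph.binomialRandom V p).real S ≤ ε := by
  rw [binomialRandom_real_eq_resample p A X hd hA hX]
  calc _ ≤ ∑ G : SimpleGraph V, weight (p : ℝ) G * ε :=
        Finset.sum_le_sum fun G _ => mul_le_mul_of_nonneg_left (h G) (weight_nonneg p G)
    _ = ε := by rw [← Finset.sum_mul, sum_weight, one_mul]

end Resampling
-- Fourier-analytic anticoncentration of the size counts of random subsets.
section Anticoncentration
open scoped Classical

set_option linter.unusedSectionVars false

lemma norm_one_add_le (z : ℂ) (hz : ‖z‖ = 1) : ‖1 + z‖ ≤ 2 - ‖z - 1‖ ^ 2 / 4 := by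
  have h : ‖1 + z‖ ^ 2 = 4 - ‖z - 1‖ ^ 2 := by
    have := parallelogram_law_with_norm ℝ (1 : ℂ) z
    rw [norm_sub_rev 1 z, hz, norm_one] at this
    nlinarith
  have h2 : ‖z - 1‖ ≤ 2 := by
    calc ‖z - 1‖ ≤ ‖z‖ + ‖(1 : ℂ)‖ := norm_sub_le _ _
      _ = 2 := by rw [hz, norm_one]; norm_num
  refine abs_le_of_sq_le_sq' ?_ ?_ |>.2
  · nlinarith [sq_nonneg (‖z - 1‖ ^ 2)]
  · nlinarith [norm_nonneg (z - 1)]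

/-- Jordan's inequality for the sine gives `‖ζ - 1‖ ≥ 4|x/M|` for `ζ` the character value at `x`,
and `norm_one_add_le` turns this into a gap below `2`. -/
lemma norm_one_add_stdAddChar_le {M : ℕ} [NeZero M] (x : ZMod M) :
    ‖1 + ZMod.stdAddChar x‖ ≤ 2 - 4 * ((x.valMinAbs : ℝ) / M) ^ 2 := by
  have hM : (0 : ℝ) < M := by exact_mod_cast Nat.pos_of_ne_zero (NeZero.ne M)
  refine (norm_one_add_le _ (AddChar.norm_apply _ _)).trans ?_
  have h1 : ‖ZMod.stdAddChar x - 1‖ = ‖2 * Real.sin (Real.pi * x.valMinAbs / M)‖ := by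
    have := Complex.norm_exp_I_mul_ofReal_sub_one (2 * (Real.pi * x.valMinAbs / M))
    rw [mul_div_cancel_left₀ _ two_ne_zero] at this
    rw [← this]
    conv_lhs => rw [← ZMod.coe_valMinAbs x, ZMod.stdAddChar_coe]
    congr 3
    push_cast
    ring
  have h2 : |Real.pi * x.valMinAbs / M| ≤ Real.pi / 2 := by
    have h3 : ((x.valMinAbs.natAbs : ℕ) : ℝ) ≤ M / 2 :=
      (Nat.cast_le.2 (ZMod.natAbs_valMinAbs_le x)).trans Nat.cast_div_le
    rw [Nat.cast_natAbs, Int.cast_abs] at h3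
    rw [abs_div, abs_mul, abs_of_pos Real.pi_pos, abs_of_pos hM, div_le_iff₀ hM]
    nlinarith [Real.pi_pos]
  have h3 := Real.mul_abs_le_abs_sin h2
  have h4 : 4 * |(x.valMinAbs : ℝ) / M| ≤ ‖ZMod.stdAddChar x - 1‖ := by
    rw [h1, Real.norm_eq_abs, abs_mul, abs_two]
    have : 2 / Real.pi * |Real.pi * x.valMinAbs / M| = 2 * |(x.valMinAbs : ℝ) / M| := by
      rw [mul_div_assoc, abs_mul, abs_of_pos Real.pi_pos]
      field_simp
    linarith
  have h5 := mul_self_le_mul_self (by positivity) h4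
  rw [← sq_abs ((x.valMinAbs : ℝ) / M)]
  nlinarith

lemma card_valMinAbs_lt_le {M : ℕ} [NeZero M] (τ : ℝ) (hτ : 0 ≤ τ) :
    (Finset.card {x : ZMod M | |(x.valMinAbs : ℝ) / M| < τ} : ℝ) ≤ 2 * τ * M + 1 := by
  have hM : (0 : ℝ) < M := by exact_mod_cast Nat.pos_of_ne_zero (NeZero.ne M)
  set b : ℤ := ⌊τ * M⌋
  have hb : 0 ≤ b := Int.floor_nonneg.2 (by positivity)
  have h : (Finset.card {x : ZMod M | |(x.valMinAbs : ℝ) / M| < τ}) ≤ (Finset.Icc (-b) b).card := by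
    refine Finset.card_le_card_of_injOn ZMod.valMinAbs ?_ ZMod.injective_valMinAbs.injOn
    intro x hx
    simp only [Finset.coe_filter, Finset.mem_univ, true_and, Set.mem_ofPred_eq] at hx
    rw [abs_div, abs_of_pos hM, div_lt_iff₀ hM] at hx
    rw [Finset.coe_Icc, Set.mem_Icc, ← abs_le]
    apply Int.le_floor.2
    rw [Int.cast_abs]
    exact hx.le
  rw [Int.card_Icc] at h
  have h2 : (((b + 1 - -b).toNat : ℕ) : ℝ) = 2 * b + 1 := by
    have : ((b + 1 - -b).toNat : ℤ) = 2 * b + 1 := by omega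
    exact_mod_cast this
  calc (Finset.card {x : ZMod M | |(x.valMinAbs : ℝ) / M| < τ} : ℝ)
      ≤ ((b + 1 - -b).toNat : ℕ) := by exact_mod_cast h
    _ = 2 * b + 1 := h2
    _ ≤ 2 * τ * M + 1 := by linarith [Int.floor_le (τ * M)]

/-- Split the frequencies at `τ`: few are smaller, and each of the others contributes at most the
value of the Gaussian at `τ`. -/
lemma sum_exp_valMinAbs_le {M : ℕ} [NeZero M] (L τ : ℝ) (hL : 0 ≤ L) (hτ : 0 ≤ τ) :
    ∑ x : ZMod M, Real.exp (-(4 * L * ((x.valMinAbs : ℝ) / M) ^ 2))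
      ≤ M * (2 * τ + 1 / M + Real.exp (-(4 * L * τ ^ 2))) := by
  have hM : (0 : ℝ) < M := by exact_mod_cast Nat.pos_of_ne_zero (NeZero.ne M)
  have hterm (x : ZMod M) : Real.exp (-(4 * L * ((x.valMinAbs : ℝ) / M) ^ 2))
      ≤ (if |(x.valMinAbs : ℝ) / M| < τ then 1 else 0) + Real.exp (-(4 * L * τ ^ 2)) := by
    split_ifs with h
    · have : Real.exp (-(4 * L * ((x.valMinAbs : ℝ) / M) ^ 2)) ≤ 1 :=
        Real.exp_le_one_iff.2 (neg_nonpos.2 (by positivity))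
      linarith [Real.exp_pos (-(4 * L * τ ^ 2))]
    · rw [zero_add, Real.exp_le_exp, neg_le_neg_iff]
      apply mul_le_mul_of_nonneg_left _ (by positivity)
      rw [← sq_abs ((x.valMinAbs : ℝ) / M)]
      exact pow_le_pow_left₀ hτ (not_lt.1 h) 2
  refine (Finset.sum_le_sum fun x _ => hterm x).trans ?_
  rw [Finset.sum_add_distrib, Finset.sum_boole, Finset.sum_const, Finset.card_univ, ZMod.card,
    nsmul_eq_mul]
  have := card_valMinAbs_lt_le (M := M) τ hτ
  have h3 : (M : ℝ) * (1 / M) = 1 := mul_one_div_cancel hM.ne'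
  nlinarith

/-- Fourier inversion on `ZMod M`. -/
lemma boole_eq_sum_stdAddChar {M : ℕ} [NeZero M] (b : ZMod M) :
    ((if b = 0 then 1 else 0 : ℝ) : ℂ) = (M : ℂ)⁻¹ * ∑ x, ZMod.stdAddChar (x * b) := by
  have hM : (M : ℂ) ≠ 0 := by exact_mod_cast NeZero.ne M
  rw [AddChar.sum_mulShift b (ZMod.isPrimitive_stdAddChar M), ZMod.card]
  split_ifs <;> simp [hM]

/-- The character attached to `θ` evaluated at level `l`. -/
noncomputable def levelChar {K M : ℕ} [NeZero M] (θ : Fin K → ZMod M) (l : ℕ) : ℂ :=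
  ∏ i : Fin K, if l = i + 1 then ZMod.stdAddChar (θ i) else 1

lemma levelChar_eq {K M : ℕ} [NeZero M] (θ : Fin K → ZMod M) (l : ℕ) :
    levelChar θ l = 1 + ∑ i : Fin K, if l = i + 1 then ZMod.stdAddChar (θ i) - 1 else 0 := by
  by_cases h : ∃ i : Fin K, l = i + 1
  · obtain ⟨i, rfl⟩ := h
    have hi (j : Fin K) : ((i : ℕ) + 1 = j + 1) ↔ i = j := by
      rw [Fin.ext_iff]
      omega
    simp only [levelChar, hi]
    simp
  · push Not at h
    simp [levelChar, h]

variable {V : Type*} [Fintype V]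

/-- The characteristic function of a single random subset. Level `0` and those above `K` have
character value `1`; half of the mass can be spared from them to pair each `ζ` with a `1`, and
cancellation in `1 + ζ` gives the decay. `hhalf` keeps the leftover coefficient nonnegative. -/
lemma norm_levelChar_sum_le {K M : ℕ} [NeZero M] (θ : Fin K → ZMod M) (p : unitInterval)
    (X : Finset V) (q : ℕ → ℝ)
    (hq : ∀ l, q l = X.card.choose l * (p : ℝ) ^ l * (1 - p) ^ (X.card - l))
    (hhalf : ∑ i : Fin K, q (i + 1) ≤ 1 / 2) :
    ‖∑ T ∈ X.powerset, (subsetWeight p X T : ℂ) * levelChar θ T.card‖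
      ≤ Real.exp (-∑ i : Fin K, q (i + 1) * (4 * (((θ i).valMinAbs : ℝ) / M) ^ 2)) := by
  have hq0 (l : ℕ) : 0 ≤ q l := by
    rw [hq]
    exact mul_nonneg (mul_nonneg (Nat.cast_nonneg _) (pow_nonneg p.2.1 _))
      (pow_nonneg (sub_nonneg.2 p.2.2) _)
  have hlevel (l : ℕ) : ∑ T ∈ X.powerset, (if T.card = l then (subsetWeight (p : ℝ) X T : ℝ) else 0)
      = q l := by
    rw [← Finset.sum_filter, ← Finset.powersetCard_eq_filter, hq]
    rw [Finset.sum_congr rfl (g := fun _ => (p : ℝ) ^ l * (1 - p) ^ (X.card - l))]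
    · rw [Finset.sum_const, Finset.card_powersetCard, nsmul_eq_mul, mul_assoc]
    · intro T hT
      rw [subsetWeight, (Finset.mem_powersetCard.1 hT).2]
  have hsum : ∑ T ∈ X.powerset, (subsetWeight p X T : ℂ) * levelChar θ T.card
      = ((1 - 2 * ∑ i : Fin K, q (i + 1) : ℝ) : ℂ)
        + ∑ i : Fin K, (q (i + 1) : ℂ) * (1 + ZMod.stdAddChar (θ i)) := by
    simp_rw [levelChar_eq, mul_add, mul_one, Finset.sum_add_distrib, Finset.mul_sum]
    rw [Finset.sum_comm]
    have h1 : ∑ T ∈ X.powerset, (subsetWeight p X T : ℂ) = 1 := by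
      rw [← Complex.ofReal_sum, sum_subsetWeight, Complex.ofReal_one]
    have h2 (i : Fin K) : ∑ T ∈ X.powerset, (subsetWeight p X T : ℂ) *
        (if T.card = i + 1 then ZMod.stdAddChar (θ i) - 1 else 0)
        = (q (i + 1) : ℂ) * (ZMod.stdAddChar (θ i) - 1) := by
      rw [← hlevel, Complex.ofReal_sum, Finset.sum_mul]
      refine Finset.sum_congr rfl fun T _ => ?_
      split_ifs <;> simp
    rw [h1, Finset.sum_congr rfl fun i _ => h2 i]
    push_cast
    simp_rw [mul_sub, mul_one, Finset.sum_sub_distrib, ← Finset.mul_sum]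
    ring
  rw [hsum]
  calc _ ≤ (1 - 2 * ∑ i : Fin K, q (i + 1))
        + ∑ i : Fin K, q (i + 1) * (2 - 4 * (((θ i).valMinAbs : ℝ) / M) ^ 2) := by
        refine (norm_add_le _ _).trans (add_le_add ?_ ((norm_sum_le _ _).trans
          (Finset.sum_le_sum fun i _ => ?_)))
        · rw [Complex.norm_real, Real.norm_eq_abs, abs_of_nonneg (by linarith)]
        · rw [norm_mul, Complex.norm_real, Real.norm_eq_abs, abs_of_nonneg (hq0 _)]
          exact mul_le_mul_of_nonneg_left (norm_one_add_stdAddChar_le _) (hq0 _)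
    _ = -(∑ i : Fin K, q (i + 1) * (4 * (((θ i).valMinAbs : ℝ) / M) ^ 2)) + 1 := by
        simp_rw [mul_sub, Finset.sum_sub_distrib, ← Finset.sum_mul]
        ring
    _ ≤ _ := Real.add_one_le_exp _

/-- The joint law of the numbers of elements of each size `1, …, K` among independent random subsets
of `X` is spread out. -/
theorem sum_choices_card_eq_le (p : unitInterval) (A X : Finset V) (K : ℕ) (t : ℕ → ℕ)
    (q : ℕ → ℝ) (hq : ∀ l, q l = X.card.choose l * (p : ℝ) ^ l * (1 - p) ^ (X.card - l))
    (hhalf : ∑ i : Fin K, q (i + 1) ≤ 1 / 2) (L τ : ℝ) (hL : 0 ≤ L) (hτ : 0 ≤ τ)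
    (hLq : ∀ i : Fin K, L ≤ A.card * q (i + 1)) :
    ∑ f ∈ choices A X, (if ∀ l, Finset.card {a ∈ A | (f a).card = l} = t l
      then ∏ a ∈ A, subsetWeight (p : ℝ) X (f a) else 0)
      ≤ (2 * τ + 1 / (A.card + 1) + Real.exp (-(4 * L * τ ^ 2))) ^ K := by
  -- Equality of counts is relaxed to congruence modulo `M`, which only enlarges the event. A
  -- modulus of order `|A|` makes the rounding term `1 / M` small.
  set M : ℕ := A.card + 1 with hM
  have hMpos : (0 : ℝ) < M := by positivity
  set w : (V → Finset V) → ℝ := fun f => ∏ a ∈ A, subsetWeight (p : ℝ) X (f a) with hw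
  have hw0 (f : V → Finset V) : 0 ≤ w f := Finset.prod_nonneg fun a _ =>
    mul_nonneg (pow_nonneg p.2.1 _) (pow_nonneg (sub_nonneg.2 p.2.2) _)
  set c : (V → Finset V) → ℕ → ℕ := fun f l => Finset.card {a ∈ A | (f a).card = l} with hc
  set I : (V → Finset V) → ℝ := fun f =>
    ∏ i : Fin K, if ((c f (i + 1) : ZMod M) - t (i + 1)) = 0 then 1 else 0 with hI
  have hle : ∑ f ∈ choices A X, (if ∀ l, c f l = t l then w f else 0)
      ≤ ∑ f ∈ choices A X, w f * I f := by
    refine Finset.sum_le_sum fun f _ => ?_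
    split_ifs with h
    · have : I f = 1 := Finset.prod_eq_one fun i _ => by simp [h]
      rw [this, mul_one]
    · refine mul_nonneg (hw0 f) (Finset.prod_nonneg fun i _ => ?_)
      split_ifs <;> norm_num
  have hIc (f : V → Finset V) : (I f : ℂ) = ((M : ℂ)⁻¹) ^ K * ∑ θ : Fin K → ZMod M,
      (∏ i : Fin K, ZMod.stdAddChar (-(θ i * (t (i + 1) : ZMod M)))) * ∏ a ∈ A, levelChar θ (f a).card := by
    rw [hI, Complex.ofReal_prod]
    simp_rw [boole_eq_sum_stdAddChar]
    rw [Finset.prod_mul_distrib, Finset.prod_const, Finset.card_univ, Fintype.card_fin,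
      Finset.prod_univ_sum, Fintype.piFinset_univ]
    congr 1
    refine Finset.sum_congr rfl fun θ _ => ?_
    simp only [levelChar]
    rw [Finset.prod_comm, ← Finset.prod_mul_distrib]
    refine Finset.prod_congr rfl fun i _ => ?_
    rw [← Finset.prod_filter, Finset.prod_const, ← AddChar.map_nsmul_eq_pow,
      ← AddChar.map_add_eq_mul]
    congr 1
    rw [nsmul_eq_mul, mul_sub]
    ring
  have hsumc : ((∑ f ∈ choices A X, w f * I f : ℝ) : ℂ) = ((M : ℂ)⁻¹) ^ K *
      ∑ θ : Fin K → ZMod M, (∏ i : Fin K, ZMod.stdAddChar (-(θ i * (t (i + 1) : ZMod M)))) *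
        (∑ T ∈ X.powerset, (subsetWeight p X T : ℂ) * levelChar θ T.card) ^ A.card := by
    rw [Complex.ofReal_sum]
    simp_rw [Complex.ofReal_mul, hIc, ← sum_choices_prod, Finset.mul_sum]
    rw [Finset.sum_comm]
    refine Finset.sum_congr rfl fun θ _ => Finset.sum_congr rfl fun f _ => ?_
    rw [Finset.prod_mul_distrib, hw, Complex.ofReal_prod]
    ring
  have hnorm : ∑ f ∈ choices A X, w f * I f ≤ ((M : ℝ)⁻¹) ^ K *
      ∑ θ : Fin K → ZMod M, ∏ i : Fin K,
        Real.exp (-(4 * L * (((θ i).valMinAbs : ℝ) / M) ^ 2)) := by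
    refine (le_abs_self _).trans ?_
    rw [← Real.norm_eq_abs, ← Complex.norm_real, hsumc, norm_mul, norm_pow, norm_inv,
      Complex.norm_natCast]
    refine mul_le_mul_of_nonneg_left ((norm_sum_le _ _).trans (Finset.sum_le_sum fun θ _ => ?_))
      (by positivity)
    rw [norm_mul, norm_prod, Finset.prod_eq_one fun i _ => AddChar.norm_apply _ _, one_mul,
      norm_pow, ← Real.exp_sum]
    refine (pow_le_pow_left₀ (norm_nonneg _)
      (norm_levelChar_sum_le θ p X q hq hhalf) _).trans ?_
    rw [← Real.exp_nat_mul, Real.exp_le_exp, Finset.sum_neg_distrib, mul_neg, neg_le_neg_iff,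
      Finset.mul_sum]
    refine Finset.sum_le_sum fun i _ => ?_
    have := mul_le_mul_of_nonneg_right (hLq i)
      (by positivity : 0 ≤ 4 * (((θ i).valMinAbs : ℝ) / M) ^ 2)
    linarith
  refine hle.trans (hnorm.trans ?_)
  have hprod := Finset.prod_univ_sum (fun _ : Fin K => (Finset.univ : Finset (ZMod M)))
    (fun _ x => Real.exp (-(4 * L * ((x.valMinAbs : ℝ) / M) ^ 2)))
  rw [Fintype.piFinset_univ, Finset.prod_const, Finset.card_univ, Fintype.card_fin] at hprod
  rw [← hprod, ← mul_pow]
  refine pow_le_pow_left₀ (mul_nonneg (by positivity)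
    (Finset.sum_nonneg fun _ _ => (Real.exp_pos _).le)) ?_ _
  rw [inv_mul_le_iff₀ hMpos]
  refine (sum_exp_valMinAbs_le L τ hL hτ).trans (le_of_eq ?_)
  rw [hM]
  push_cast
  rfl

end Anticoncentration
-- Chernoff bounds and the collision probability of two profiles.
section Collision
open scoped Classical

set_option linter.unusedSectionVars false

variable {V : Type*} [Fintype V]

/-- Markov's inequality for `c` to the number of neighbours of `a` in `S G`. Given `S G` that number
is binomial, although `S G` is random. Taking `c = 2` and `c = 1/2` yields the two tails. -/
theorem binomialRandom_real_le_of_generating (p : unitInterval) (a : V)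
    (S : SimpleGraph V → Finset V) (ha : ∀ G, a ∉ S G)
    (hS : ∀ G, ∀ f ∈ choices {a} (S G), S (rewire G {a} (S G) f) = S G)
    (E : Set (SimpleGraph V)) (c B ε : ℝ) (hc : 0 ≤ c) (hB : 0 ≤ B) (hε : 0 ≤ ε)
    (h1 : ∀ G ∈ E, 1 ≤ B * c ^ Finset.card {x ∈ S G | G.Adj a x})
    (h2 : ∀ G ∈ E, B * (1 + (c - 1) * p) ^ (S G).card ≤ ε) :
    (SimpleGraph.binomialRandom V p).real E ≤ ε := by
  have hd (G : SimpleGraph V) : Disjoint {a} (S G) := Finset.disjoint_singleton_left.2 (ha G)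
  refine binomialRandom_real_le_of_resample p (fun _ => {a}) S hd (fun _ _ _ => rfl) hS E ε ?_
  intro G
  by_cases hex : ∃ f ∈ choices {a} (S G), rewire G {a} (S G) f ∈ E
  · obtain ⟨f₀, hf₀, hE₀⟩ := hex
    have hbound := h2 _ hE₀
    rw [hS G f₀ hf₀] at hbound
    refine le_trans ?_ hbound
    calc _ ≤ ∑ f ∈ choices {a} (S G),
            B * ∏ b ∈ {a}, (subsetWeight (p : ℝ) (S G) (f b) * c ^ (f b).card) := by
          refine Finset.sum_le_sum fun f hf => ?_
          have hw : 0 ≤ subsetWeight (p : ℝ) (S G) (f a) :=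
            mul_nonneg (pow_nonneg p.2.1 _) (pow_nonneg (sub_nonneg.2 p.2.2) _)
          rw [Finset.prod_singleton, Finset.prod_singleton]
          split_ifs with hE
          · have h3 := h1 _ hE
            have h4 : {x ∈ S G | (rewire G {a} (S G) f).Adj a x} = f a := by
              have := congrFun (trace_rewire (G := G) (hd G) hf) a
              simpa [trace] using this
            rw [hS G f hf, h4] at h3
            calc _ = subsetWeight (p : ℝ) (S G) (f a) * 1 := (mul_one _).symm
              _ ≤ subsetWeight (p : ℝ) (S G) (f a) * (B * c ^ (f a).card) :=
                mul_le_mul_of_nonneg_left h3 hw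
              _ = _ := by ring
          · positivity
      _ = B * (1 + (c - 1) * p) ^ (S G).card := by
          rw [← Finset.mul_sum, sum_choices_prod _ _
            (fun T => subsetWeight (p : ℝ) (S G) T * c ^ T.card), Finset.card_singleton, pow_one]
          congr 1
          have := Finset.sum_pow_mul_eq_add_pow (c * p : ℝ) (1 - p : ℝ) (S G)
          rw [show c * (p : ℝ) + (1 - p) = 1 + (c - 1) * p by ring] at this
          rw [← this]
          refine Finset.sum_congr rfl fun T _ => ?_
          rw [subsetWeight, mul_pow]
          ring
  · push Not at hex
    rw [Finset.sum_eq_zero fun f hf => if_neg (hex f hf)]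
    exact hε

theorem upper_tail (p : unitInterval) (a : V) (S : SimpleGraph V → Finset V) (ha : ∀ G, a ∉ S G)
    (hS : ∀ G, ∀ f ∈ choices {a} (S G), S (rewire G {a} (S G) f) = S G) (s D : ℕ) :
    (SimpleGraph.binomialRandom V p).real
      {G | (S G).card ≤ s ∧ D ≤ Finset.card {x ∈ S G | G.Adj a x}} ≤ (1 / 2) ^ D * (1 + p) ^ s := by
  have hp := p.2.1
  refine binomialRandom_real_le_of_generating p a S ha hS _ 2 ((1 / 2) ^ D) _ (by norm_num)
    (by positivity) (by positivity) ?_ ?_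
  · rintro G ⟨-, h⟩
    calc (1 : ℝ) = (1 / 2) ^ D * 2 ^ D := by rw [← mul_pow]; norm_num
      _ ≤ _ := mul_le_mul_of_nonneg_left (pow_le_pow_right₀ (by norm_num) h) (by positivity)
  · rintro G ⟨h, -⟩
    refine mul_le_mul_of_nonneg_left ?_ (by positivity)
    rw [show 1 + (2 - 1) * (p : ℝ) = 1 + p by ring]
    exact pow_le_pow_right₀ (by linarith) h

theorem lower_tail (p : unitInterval) (a : V) (S : SimpleGraph V → Finset V) (ha : ∀ G, a ∉ S G)
    (hS : ∀ G, ∀ f ∈ choices {a} (S G), S (rewire G {a} (S G) f) = S G) (s d : ℕ) :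
    (SimpleGraph.binomialRandom V p).real
      {G | s ≤ (S G).card ∧ Finset.card {x ∈ S G | G.Adj a x} ≤ d} ≤ 2 ^ d * (1 - p / 2) ^ s := by
  have hp := p.2.1
  have hp' := p.2.2
  have h0 : 0 ≤ 1 - (p : ℝ) / 2 := by linarith
  refine binomialRandom_real_le_of_generating p a S ha hS _ (1 / 2) (2 ^ d) _ (by norm_num)
    (by positivity) (by positivity) ?_ ?_
  · rintro G ⟨-, h⟩
    calc (1 : ℝ) = 2 ^ d * (1 / 2) ^ d := by rw [← mul_pow]; norm_num
      _ ≤ _ := mul_le_mul_of_nonneg_left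
        (pow_le_pow_of_le_one (by norm_num) (by norm_num) h) (by positivity)
  · rintro G ⟨h, -⟩
    refine mul_le_mul_of_nonneg_left ?_ (by positivity)
    rw [show 1 + (1 / 2 - 1) * (p : ℝ) = 1 - p / 2 by ring]
    exact pow_le_pow_of_le_one h0 (by linarith) h

/-- The neighbours of `u` as a finite set. -/
noncomputable def nb (G : SimpleGraph V) (u : V) : Finset V := {x | G.Adj u x}

/-- `target j G v` as a finite set. -/
noncomputable def tgt (j : Bool) (G : SimpleGraph V) (v : V) : Finset V := {x | x ∈ target j G v}

@[simp] lemma mem_nb {G : SimpleGraph V} {u x : V} : x ∈ nb G u ↔ G.Adj u x := by simp [nb]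

@[simp] lemma mem_tgt {j : Bool} {G : SimpleGraph V} {v x : V} :
    x ∈ tgt j G v ↔ x ∈ target j G v := by simp [tgt]

lemma tgt_false (G : SimpleGraph V) (v : V) : tgt false G v = nb G v := by
  ext x
  simp [target]

lemma tgt_true (G : SimpleGraph V) (v : V) : tgt true G v = (nb G v).biUnion (nb G) := by
  ext x
  simp [target]

lemma profile_eq_card (j : Bool) (G : SimpleGraph V) (u v : V) (k : ℕ) :
    profile j G u v k
      = Finset.card {a ∈ nb G u | Finset.card {x ∈ tgt j G v | G.Adj a x} = k} := by
  have inner (a : V) : {x | G.Adj a x ∧ x ∈ target j G v}.ncard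
      = Finset.card {x ∈ tgt j G v | G.Adj a x} := by
    rw [← Set.ncard_coe_finset]
    congr 1
    ext x
    simp [and_comm]
  rw [profile, ← Set.ncard_coe_finset]
  congr 1
  ext a
  simp [inner]

lemma nb_rewire {G : SimpleGraph V} {A X : Finset V} {w : V} (hA : w ∉ A) (hX : w ∉ X)
    (f : V → Finset V) : nb (rewire G A X f) w = nb G w := by
  ext x
  rw [mem_nb, mem_nb, rewire_adj_of_not (by tauto) (by tauto)]

lemma tgt_rewire {j : Bool} {G : SimpleGraph V} {A X : Finset V} {w : V} (hA : w ∉ A) (hX : w ∉ X)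
    (hj : j = true → ∀ b ∈ nb G w, b ∉ A ∧ b ∉ X) (f : V → Finset V) :
    tgt j (rewire G A X f) w = tgt j G w := by
  cases j
  · rw [tgt_false, tgt_false, nb_rewire hA hX]
  · rw [tgt_true, tgt_true, nb_rewire hA hX]
    exact Finset.biUnion_congr rfl fun b hb => nb_rewire (hj rfl b hb).1 (hj rfl b hb).2 f

/-- A subset of `s` with `m` elements, if there is one. -/
noncomputable def pickSubset (m : ℕ) (s : Finset V) : Finset V :=
  if h : m ≤ s.card then (Finset.exists_subset_card_eq h).choose else ∅

lemma pickSubset_subset (m : ℕ) (s : Finset V) : pickSubset m s ⊆ s := by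
  unfold pickSubset
  split_ifs with h
  · exact (Finset.exists_subset_card_eq h).choose_spec.1
  · exact Finset.empty_subset _

lemma card_pickSubset {m : ℕ} {s : Finset V} (h : m ≤ s.card) : (pickSubset m s).card = m := by
  rw [pickSubset, dif_pos h]
  exact (Finset.exists_subset_card_eq h).choose_spec.2

/-- A member of the family `F` with at least `N` elements, if there is one. -/
noncomputable def pickMember (N : ℕ) (F : ℕ → Finset V) : Finset V :=
  if h : ∃ k, N ≤ (F k).card then F h.choose else ∅

/-- The neighbours of `u` away from `v`, `u'`, `v'` and their neighbourhoods. -/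
noncomputable def freeNb (G : SimpleGraph V) (u v u' v' : V) : Finset V :=
  nb G u \ (nb G v ∪ nb G u' ∪ nb G v' ∪ {v, u', v'})

/-- The part of `tgt j G v` that can be resampled without changing `profile j G u' v'`. -/
noncomputable def freeTgt (j : Bool) (G : SimpleGraph V) (u v u' v' : V) : Finset V :=
  tgt j G v \ (nb G u ∪ {u, v, u', v'} ∪ if j then nb G v ∪ nb G u' ∪ nb G v' else ∅)

/-- The vertices of `freeNb G u v u' v'` with exactly `k` neighbours in the part of `tgt j G v` that
is not resampled. -/
noncomputable def offsetClass (j : Bool) (m : ℕ) (G : SimpleGraph V) (u v u' v' : V) (k : ℕ) :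
    Finset V :=
  {a ∈ freeNb G u v u' v' |
    Finset.card {x ∈ tgt j G v \ pickSubset m (freeTgt j G u v u' v') | G.Adj a x} = k}

/-- There is enough freedom left to resample. -/
def Ample (j : Bool) (m N : ℕ) (u v u' v' : V) (G : SimpleGraph V) : Prop :=
  m ≤ (freeTgt j G u v u' v').card ∧ ∃ k, N ≤ (offsetClass j m G u v u' v' k).card

lemma pickMember_offsetClass_subset (j : Bool) (m N : ℕ) (G : SimpleGraph V) (u v u' v' : V) :
    pickMember N (offsetClass j m G u v u' v') ⊆ freeNb G u v u' v' := by
  unfold pickMember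
  split_ifs
  · exact Finset.filter_subset _ _
  · exact Finset.empty_subset _

section Stable

variable {j : Bool} {G : SimpleGraph V} {u v u' v' : V} {A X : Finset V}

lemma mem_freeNb {a : V} : a ∈ freeNb G u v u' v' ↔ G.Adj u a ∧ ¬ G.Adj v a ∧ ¬ G.Adj u' a ∧
    ¬ G.Adj v' a ∧ a ≠ v ∧ a ≠ u' ∧ a ≠ v' := by
  simp only [freeNb, Finset.mem_sdiff, Finset.mem_union, mem_nb, Finset.mem_insert,
    Finset.mem_singleton]
  tauto

lemma of_mem_freeTgt {x : V} (h : x ∈ freeTgt j G u v u' v') : x ∈ tgt j G v ∧ ¬ G.Adj u x ∧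
    x ≠ u ∧ x ≠ v ∧ x ≠ u' ∧ x ≠ v' := by
  simp only [freeTgt, Finset.mem_sdiff, Finset.mem_union, mem_nb, Finset.mem_insert,
    Finset.mem_singleton] at h
  tauto

lemma of_mem_freeTgt_true {x : V} (h : x ∈ freeTgt true G u v u' v') :
    ¬ G.Adj v x ∧ ¬ G.Adj u' x ∧ ¬ G.Adj v' x := by
  simp only [freeTgt, Finset.mem_sdiff, Finset.mem_union, mem_nb, if_true] at h
  tauto

variable (hA : A ⊆ freeNb G u v u' v') (hX : X ⊆ freeTgt j G u v u' v')
include hA hX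

lemma disjoint_of_subset_free : Disjoint A X :=
  Finset.disjoint_left.2 fun _ ha hx => (of_mem_freeTgt (hX hx)).2.1 (mem_freeNb.1 (hA ha)).1

lemma nb_rewire_free (f : V → Finset V) :
    nb (rewire G A X f) u = nb G u ∧ nb (rewire G A X f) v = nb G v ∧
      nb (rewire G A X f) u' = nb G u' ∧ nb (rewire G A X f) v' = nb G v' := by
  refine ⟨nb_rewire ?_ ?_ f, nb_rewire ?_ ?_ f, nb_rewire ?_ ?_ f, nb_rewire ?_ ?_ f⟩ <;>
    intro h
  · exact (mem_freeNb.1 (hA h)).1.ne rfl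
  · exact (of_mem_freeTgt (hX h)).2.2.1 rfl
  · exact (mem_freeNb.1 (hA h)).2.2.2.2.1 rfl
  · exact (of_mem_freeTgt (hX h)).2.2.2.1 rfl
  · exact (mem_freeNb.1 (hA h)).2.2.2.2.2.1 rfl
  · exact (of_mem_freeTgt (hX h)).2.2.2.2.1 rfl
  · exact (mem_freeNb.1 (hA h)).2.2.2.2.2.2 rfl
  · exact (of_mem_freeTgt (hX h)).2.2.2.2.2 rfl

lemma tgt_rewire_free (f : V → Finset V) :
    tgt j (rewire G A X f) v = tgt j G v ∧ tgt j (rewire G A X f) v' = tgt j G v' := by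
  constructor
  · refine tgt_rewire (fun h => (mem_freeNb.1 (hA h)).2.2.2.2.1 rfl)
      (fun h => (of_mem_freeTgt (hX h)).2.2.2.1 rfl) ?_ f
    rintro rfl b hb
    rw [mem_nb] at hb
    exact ⟨fun h => (mem_freeNb.1 (hA h)).2.1 hb, fun h => (of_mem_freeTgt_true (hX h)).1 hb⟩
  · refine tgt_rewire (fun h => (mem_freeNb.1 (hA h)).2.2.2.2.2.2 rfl)
      (fun h => (of_mem_freeTgt (hX h)).2.2.2.2.2 rfl) ?_ f
    rintro rfl b hb
    rw [mem_nb] at hb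
    exact ⟨fun h => (mem_freeNb.1 (hA h)).2.2.2.1 hb,
      fun h => (of_mem_freeTgt_true (hX h)).2.2 hb⟩

lemma free_rewire (f : V → Finset V) :
    freeNb (rewire G A X f) u v u' v' = freeNb G u v u' v' ∧
      freeTgt j (rewire G A X f) u v u' v' = freeTgt j G u v u' v' := by
  obtain ⟨h1, h2, h3, h4⟩ := nb_rewire_free hA hX f
  obtain ⟨h5, -⟩ := tgt_rewire_free hA hX f
  simp only [freeNb, freeTgt, h1, h2, h3, h4, h5, and_self]

/-- Rewiring does not affect the adjacency of a neighbour of `u` outside of the resampled part. -/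
lemma rewire_adj_of_adj {a x : V} (f : V → Finset V) (ha : G.Adj u a) (h : a ∉ A ∨ x ∉ X) :
    (rewire G A X f).Adj a x ↔ G.Adj a x :=
  rewire_adj_of_not (by tauto) fun h' => (of_mem_freeTgt (hX h'.2)).2.1 ha

/-- A pair in `A × X` could matter only through a neighbour of `u'` lying in `A` or in `X`. `A`
avoids the neighbours of `u'` and `v'`, which suffices when the target is `nb G v'`; for the second
neighbourhood `X` avoids the neighbours of `u'` too. -/
lemma profile_rewire_right (f : V → Finset V) (k : ℕ) :
    profile j (rewire G A X f) u' v' k = profile j G u' v' k := by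
  rw [profile_eq_card, profile_eq_card, (nb_rewire_free hA hX f).2.2.1,
    (tgt_rewire_free hA hX f).2]
  congr 1
  refine Finset.filter_congr fun c hc => ?_
  rw [mem_nb] at hc
  have : {x ∈ tgt j G v' | (rewire G A X f).Adj c x} = {x ∈ tgt j G v' | G.Adj c x} := by
    refine Finset.filter_congr fun x hx => rewire_adj_of_not ?_ ?_
    · exact fun h => (mem_freeNb.1 (hA h.1)).2.2.1 hc
    · rintro ⟨h1, h2⟩
      cases j
      · rw [tgt_false, mem_nb] at hx
        exact (mem_freeNb.1 (hA h1)).2.2.2.1 hx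
      · exact (of_mem_freeTgt_true (hX h2)).2.1 hc
  rw [this]

end Stable

/-- Equality as functions of `k` matters: it guarantees that `pickMember` makes the same choice
before and after rewiring. -/
lemma offsetClass_rewire {j : Bool} {m : ℕ} {G : SimpleGraph V} {u v u' v' : V} {A : Finset V}
    (hA : A ⊆ freeNb G u v u' v') (f : V → Finset V) :
    offsetClass j m (rewire G A (pickSubset m (freeTgt j G u v u' v')) f) u v u' v'
      = offsetClass j m G u v u' v' := by
  have hX := pickSubset_subset m (freeTgt j G u v u' v')
  funext k
  obtain ⟨h1, h2⟩ := free_rewire hA hX f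
  rw [offsetClass, offsetClass, h1, h2, (tgt_rewire_free hA hX f).1]
  refine Finset.filter_congr fun a ha => ?_
  rw [Finset.filter_congr fun x hx => rewire_adj_of_adj hA hX f (mem_freeNb.1 ha).1
    (.inr (Finset.mem_sdiff.1 hx).2)]

/-- Every vertex of `A` has exactly `k₀` neighbours in the target outside `X`, so the resampled
subset sizes appear as counts shifted by `k₀`, plus a term that does not depend on `f`. -/
lemma profile_rewire_left {j : Bool} {m : ℕ} {G : SimpleGraph V} {u v u' v' : V} {A : Finset V}
    {k₀ : ℕ} (hA : A = offsetClass j m G u v u' v' k₀) {f : V → Finset V}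
    (hf : f ∈ choices A (pickSubset m (freeTgt j G u v u' v'))) (l : ℕ) :
    profile j (rewire G A (pickSubset m (freeTgt j G u v u' v')) f) u v (k₀ + l)
      = Finset.card {a ∈ A | (f a).card = l}
        + Finset.card {a ∈ nb G u \ A | Finset.card {x ∈ tgt j G v | G.Adj a x} = k₀ + l} := by
  set X := pickSubset m (freeTgt j G u v u' v') with hXdef
  have hA' : A ⊆ freeNb G u v u' v' := hA ▸ Finset.filter_subset _ _
  have hX : X ⊆ freeTgt j G u v u' v' := pickSubset_subset _ _
  have hd := disjoint_of_subset_free hA' hX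
  have hAu : A ⊆ nb G u := fun a ha => mem_nb.2 (mem_freeNb.1 (hA' ha)).1
  have hXt : X ⊆ tgt j G v := fun x hx => (of_mem_freeTgt (hX hx)).1
  rw [profile_eq_card, (nb_rewire_free hA' hX f).1, (tgt_rewire_free hA' hX f).1]
  conv_lhs => rw [← Finset.union_sdiff_of_subset hAu]
  rw [Finset.filter_union, Finset.card_union_of_disjoint
    (Finset.disjoint_filter_filter Finset.disjoint_sdiff)]
  congr 1
  · congr 1
    refine Finset.filter_congr fun a ha => ?_
    have hau : G.Adj u a := mem_nb.1 (hAu ha)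
    have h1 : Finset.card {x ∈ tgt j G v | (rewire G A X f).Adj a x} = (f a).card + k₀ := by
      rw [← Finset.union_sdiff_of_subset hXt, Finset.filter_union, Finset.card_union_of_disjoint
        (Finset.disjoint_filter_filter Finset.disjoint_sdiff)]
      congr 1
      · have := congrFun (trace_rewire (G := G) hd hf) a
        rw [trace, if_pos ha] at this
        rw [this]
      · rw [hA, offsetClass, Finset.mem_filter] at ha
        rw [← ha.2, Finset.filter_congr fun x hx => rewire_adj_of_adj hA' hX f hau
          (.inr (Finset.mem_sdiff.1 hx).2)]
    rw [h1]
    omega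
  · congr 1
    refine Finset.filter_congr fun a ha => ?_
    rw [Finset.mem_sdiff, mem_nb] at ha
    rw [Finset.filter_congr fun x _ => rewire_adj_of_adj hA' hX f ha.1 (.inl ha.2)]

/-- Two rooted edges have the same profile with small probability. -/
theorem binomialRandom_real_collision_le (p : unitInterval) (j : Bool) (m N : ℕ) (u v u' v' : V)
    (ε : ℝ) (hε : 0 ≤ ε)
    (h : ∀ (A X : Finset V) (t : ℕ → ℕ), N ≤ A.card → X.card = m →
      ∑ f ∈ choices A X, (if ∀ l, Finset.card {a ∈ A | (f a).card = l} = t l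
        then ∏ a ∈ A, subsetWeight (p : ℝ) X (f a) else 0) ≤ ε) :
    (SimpleGraph.binomialRandom V p).real
      {G | Ample j m N u v u' v' G ∧ ∀ k, profile j G u v k = profile j G u' v' k} ≤ ε := by
  have hsub (G : SimpleGraph V) := pickMember_offsetClass_subset j m N G u v u' v'
  have hsub' (G : SimpleGraph V) := pickSubset_subset m (freeTgt j G u v u' v')
  refine binomialRandom_real_le_of_resample p
    (fun G => pickMember N (offsetClass j m G u v u' v'))
    (fun G => pickSubset m (freeTgt j G u v u' v'))
    (fun G => disjoint_of_subset_free (hsub G) (hsub' G)) ?_ ?_ _ ε ?_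
  · intro G f _
    rw [offsetClass_rewire (hsub G)]
  · intro G f _
    simp only [(free_rewire (hsub G) (hsub' G) f).2]
  intro G
  by_cases hG : Ample j m N u v u' v' G
  · obtain ⟨hm, hN⟩ := hG
    set A := pickMember N (offsetClass j m G u v u' v') with hAdef
    set X := pickSubset m (freeTgt j G u v u' v') with hXdef
    have hA : A = offsetClass j m G u v u' v' hN.choose := by rw [hAdef, pickMember, dif_pos hN]
    refine le_trans (Finset.sum_le_sum fun f hf => ?_) (h A X
      -- The truncated subtraction is harmless: in a collision the profile of `(u', v')` is this
      -- fixed term plus a count.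
      (fun l => profile j G u' v' (hN.choose + l) - Finset.card {a ∈ nb G u \ A |
        Finset.card {x ∈ tgt j G v | G.Adj a x} = hN.choose + l})
      (hA ▸ hN.choose_spec) (card_pickSubset hm))
    have hw : 0 ≤ ∏ a ∈ A, subsetWeight (p : ℝ) X (f a) := Finset.prod_nonneg fun a _ =>
      mul_nonneg (pow_nonneg p.2.1 _) (pow_nonneg (sub_nonneg.2 p.2.2) _)
    by_cases hmem : rewire G A X f ∈
        {G | Ample j m N u v u' v' G ∧ ∀ k, profile j G u v k = profile j G u' v' k}
    · rw [if_pos hmem, if_pos]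
      intro l
      have h1 := hmem.2 (hN.choose + l)
      rw [profile_rewire_left hA hf, profile_rewire_right (hsub G) (hsub' G)] at h1
      omega
    · rw [if_neg hmem]
      split_ifs
      exacts [hw, le_rfl]
  · refine le_of_eq_of_le (Finset.sum_eq_zero fun f _ => if_neg ?_) hε
    rintro ⟨h1, -⟩
    apply hG
    rw [Ample, (free_rewire (hsub G) (hsub' G) f).2, offsetClass_rewire (hsub G)] at h1
    exact h1

end Collision
-- Degree and codegree conditions that leave enough room to resample.
section GoodGraphs
open scoped Classical
open MeasureTheory

set_option linter.unusedSectionVars false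

variable {V : Type*} [Fintype V]

/-- Pigeonhole over the `B + 1` possible numbers of neighbours in the unresampled part of the
target. -/
lemma exists_le_card_offsetClass {j : Bool} {m N B : ℕ} {G : SimpleGraph V} {u v u' v' : V}
    (hB : ∀ a ∈ freeNb G u v u' v', Finset.card {x ∈ tgt j G v | G.Adj a x} ≤ B)
    (hN : (B + 1) * N ≤ (freeNb G u v u' v').card) :
    ∃ k, N ≤ (offsetClass j m G u v u' v' k).card := by
  obtain ⟨k, -, hk⟩ := Finset.exists_le_card_fiber_of_mul_le_card_of_maps_to
    (s := freeNb G u v u' v') (t := Finset.range (B + 1))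
    (f := fun a => Finset.card
      {x ∈ tgt j G v \ pickSubset m (freeTgt j G u v u' v') | G.Adj a x}) (n := N)
    (fun a ha => Finset.mem_range.2 (Nat.lt_succ_of_le ((Finset.card_le_card
      (Finset.filter_subset_filter _ Finset.sdiff_subset)).trans (hB a ha))))
    ⟨0, by simp⟩ (by simpa using hN)
  exact ⟨k, hk⟩

lemma card_freeNb_ge {dmin C : ℕ} {G : SimpleGraph V} {u v u' v' : V}
    (hmin : ∀ w, dmin ≤ (nb G w).card)
    (hC : ∀ a b, a ≠ b → Finset.card {x ∈ nb G b | G.Adj a x} ≤ C)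
    (huv : u ≠ v) (huu' : u ≠ u') (huv' : u ≠ v') :
    dmin ≤ (freeNb G u v u' v').card + (3 * C + 3) := by
  have hinter (w : V) (h : u ≠ w) : (nb G u ∩ nb G w).card ≤ C := by
    refine le_trans (le_of_eq ?_) (hC u w h)
    congr 1
    ext x
    simp [and_comm]
  have hsub : nb G u ⊆ freeNb G u v u' v' ∪ ((nb G u ∩ nb G v) ∪ (nb G u ∩ nb G u') ∪
      (nb G u ∩ nb G v') ∪ {v, u', v'}) := by
    intro x hx
    simp only [freeNb, Finset.mem_union, Finset.mem_sdiff, Finset.mem_inter]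
    tauto
  have h1 := Finset.card_le_card hsub
  have h2 := Finset.card_union_le (freeNb G u v u' v') ((nb G u ∩ nb G v) ∪ (nb G u ∩ nb G u') ∪
      (nb G u ∩ nb G v') ∪ {v, u', v'})
  have h3 := Finset.card_union_le ((nb G u ∩ nb G v) ∪ (nb G u ∩ nb G u') ∪
      (nb G u ∩ nb G v')) {v, u', v'}
  have h4 := Finset.card_union_le ((nb G u ∩ nb G v) ∪ (nb G u ∩ nb G u')) (nb G u ∩ nb G v')
  have h5 := Finset.card_union_le (nb G u ∩ nb G v) (nb G u ∩ nb G u')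
  have h6 := Finset.card_le_three (a := v) (b := u') (c := v')
  have h7 := hinter v huv
  have h8 := hinter u' huu'
  have h9 := hinter v' huv'
  have h10 := hmin u
  omega

lemma ample_false {dmin C m N : ℕ} {G : SimpleGraph V} {u v u' v' : V}
    (hmin : ∀ w, dmin ≤ (nb G w).card)
    (hC : ∀ a b, a ≠ b → Finset.card {x ∈ nb G b | G.Adj a x} ≤ C)
    (huv : u ≠ v) (huu' : u ≠ u') (huv' : u ≠ v')
    (hN : (C + 1) * N + (3 * C + 3) ≤ dmin) (hm : m + C + 4 ≤ dmin) :
    Ample false m N u v u' v' G := by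
  constructor
  · have hsub : nb G v ⊆ freeTgt false G u v u' v' ∪
        ({x ∈ nb G v | G.Adj u x} ∪ {u, v, u', v'}) := by
      intro x hx
      rw [Finset.mem_union, Finset.mem_union, Finset.mem_filter, freeTgt, tgt_false,
        Finset.mem_sdiff, Finset.mem_union, Finset.mem_union, mem_nb (u := u)]
      simp only [Bool.false_eq_true, if_false, Finset.notMem_empty, or_false]
      tauto
    have h1 := Finset.card_le_card hsub
    have h2 := Finset.card_union_le (freeTgt false G u v u' v')
      ({x ∈ nb G v | G.Adj u x} ∪ {u, v, u', v'})
    have h3 := Finset.card_union_le {x ∈ nb G v | G.Adj u x} {u, v, u', v'}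
    have h4 := Finset.card_le_four (a := u) (b := v) (c := u') (d := v')
    have h5 := hC u v huv
    have h6 := hmin v
    omega
  · refine exists_le_card_offsetClass (B := C) (fun a ha => ?_) ?_
    · rw [tgt_false]
      exact hC a v (mem_freeNb.1 ha).2.2.2.2.1
    · have := card_freeNb_ge hmin hC huv huu' huv'
      omega

/-- Double counting of the edges from `nb G v` to the target without `v`: each neighbour of `v`
sends at least `dmin - 1` of them, and each target vertex receives at most `C`. -/
lemma card_tgt_true_ge {dmin C : ℕ} {G : SimpleGraph V} (hmin : ∀ w, dmin ≤ (nb G w).card)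
    (hC : ∀ a b, a ≠ b → Finset.card {x ∈ nb G b | G.Adj a x} ≤ C) (v : V) :
    dmin * (dmin - 1) ≤ (tgt true G v).card * C := by
  calc dmin * (dmin - 1) ≤ (nb G v).card * (dmin - 1) := Nat.mul_le_mul_right _ (hmin v)
    _ = ∑ b ∈ nb G v, (dmin - 1) := by rw [Finset.sum_const, smul_eq_mul]
    _ ≤ ∑ b ∈ nb G v, Finset.card {x ∈ (tgt true G v).erase v | G.Adj b x} := by
        refine Finset.sum_le_sum fun b hb => ?_
        have hsub : (nb G b).erase v ⊆ {x ∈ (tgt true G v).erase v | G.Adj b x} := by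
          intro x hx
          rw [Finset.mem_erase, mem_nb] at hx
          rw [Finset.mem_filter, Finset.mem_erase, tgt_true, Finset.mem_biUnion]
          exact ⟨⟨hx.1, b, hb, mem_nb.2 hx.2⟩, hx.2⟩
        exact (Nat.sub_le_sub_right (hmin b) 1).trans
          (Finset.pred_card_le_card_erase.trans (Finset.card_le_card hsub))
    _ = ∑ x ∈ (tgt true G v).erase v, Finset.card {b ∈ nb G v | G.Adj b x} :=
        Finset.sum_card_bipartiteAbove_eq_sum_card_bipartiteBelow _
    _ ≤ ∑ x ∈ (tgt true G v).erase v, C := by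
        refine Finset.sum_le_sum fun x hx => ?_
        simp_rw [G.adj_comm _ x]
        exact hC x v (Finset.ne_of_mem_erase hx)
    _ ≤ (tgt true G v).card * C := by
        rw [Finset.sum_const, smul_eq_mul]
        exact Nat.mul_le_mul_right _ (Finset.card_erase_le)

/-- The vertices at distance two from `v` other than `a`, provided that `a` is not adjacent
to `v`. -/
noncomputable def secondNb (v a : V) (G : SimpleGraph V) : Finset V :=
  if G.Adj v a then ∅ else tgt true G v \ (nb G v ∪ {v, a})

lemma ample_true {dmin dmax C D m N : ℕ} {G : SimpleGraph V} {u v u' v' : V}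
    (hmin : ∀ w, dmin ≤ (nb G w).card) (hmax : ∀ w, (nb G w).card ≤ dmax)
    (hC : ∀ a b, a ≠ b → Finset.card {x ∈ nb G b | G.Adj a x} ≤ C)
    (hD : ∀ v a, v ≠ a → Finset.card {x ∈ secondNb v a G | G.Adj a x} ≤ D)
    (huv : u ≠ v) (huu' : u ≠ u') (huv' : u ≠ v') (hC0 : 0 < C)
    (hN : (D + C + 3) * N + (3 * C + 3) ≤ dmin)
    (hm : (m + 4 * dmax + 4) * C ≤ dmin * (dmin - 1)) :
    Ample true m N u v u' v' G := by
  constructor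
  · have h0 : m + 4 * dmax + 4 ≤ (tgt true G v).card :=
      Nat.le_of_mul_le_mul_right (hm.trans (card_tgt_true_ge hmin hC v)) hC0
    have hsub : tgt true G v ⊆ freeTgt true G u v u' v' ∪
        (nb G u ∪ nb G v ∪ nb G u' ∪ nb G v' ∪ {u, v, u', v'}) := by
      intro x hx
      rw [Finset.mem_union, freeTgt, Finset.mem_sdiff, if_pos rfl]
      simp only [Finset.mem_union]
      tauto
    have h1 := Finset.card_le_card hsub
    have h2 := Finset.card_union_le (freeTgt true G u v u' v')
      (nb G u ∪ nb G v ∪ nb G u' ∪ nb G v' ∪ {u, v, u', v'})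
    have h3 := Finset.card_union_le (nb G u ∪ nb G v ∪ nb G u' ∪ nb G v') {u, v, u', v'}
    have h4 := Finset.card_union_le (nb G u ∪ nb G v ∪ nb G u') (nb G v')
    have h5 := Finset.card_union_le (nb G u ∪ nb G v) (nb G u')
    have h6 := Finset.card_union_le (nb G u) (nb G v)
    have h7 := Finset.card_le_four (a := u) (b := v) (c := u') (d := v')
    have := hmax u
    have := hmax v
    have := hmax u'
    have := hmax v'
    omega
  · refine exists_le_card_offsetClass (B := D + C + 2) (fun a ha => ?_) ?_
    · rw [mem_freeNb] at ha
      have hsub : {x ∈ tgt true G v | G.Adj a x} ⊆ {x ∈ secondNb v a G | G.Adj a x} ∪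
          ({x ∈ nb G v | G.Adj a x} ∪ {v, a}) := by
        intro x hx
        rw [Finset.mem_filter] at hx
        rw [Finset.mem_union, Finset.mem_union, Finset.mem_filter, Finset.mem_filter, secondNb,
          if_neg ha.2.1, Finset.mem_sdiff, Finset.mem_union]
        tauto
      have h1 := Finset.card_le_card hsub
      have h2 := Finset.card_union_le {x ∈ secondNb v a G | G.Adj a x}
        ({x ∈ nb G v | G.Adj a x} ∪ {v, a})
      have h3 := Finset.card_union_le {x ∈ nb G v | G.Adj a x} {v, a}
      have h4 := Finset.card_le_two (a := v) (b := a)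
      have h5 := hC a v ha.2.2.2.2.1
      have h6 := hD v a ha.2.2.2.2.1.symm
      omega
    · have h1 := card_freeNb_ge hmin hC huv huu' huv'
      have h2 : (D + C + 2 + 1) * N = (D + C + 3) * N := rfl
      omega

lemma card_tgt_true_le {dmax : ℕ} {G : SimpleGraph V} (hmax : ∀ w, (nb G w).card ≤ dmax) (v : V) :
    (tgt true G v).card ≤ dmax ^ 2 := by
  rw [tgt_true, pow_two]
  exact Finset.card_biUnion_le.trans ((Finset.sum_le_card_nsmul _ _ dmax fun b _ => hmax b).trans
    (by rw [smul_eq_mul]; exact Nat.mul_le_mul_right _ (hmax v)))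

lemma card_secondNb_le {dmax : ℕ} {G : SimpleGraph V} (hmax : ∀ w, (nb G w).card ≤ dmax)
    (v a : V) : (secondNb v a G).card ≤ dmax ^ 2 := by
  refine (Finset.card_le_card ?_).trans (card_tgt_true_le hmax v)
  rw [secondNb]
  split_ifs
  exacts [Finset.empty_subset _, Finset.sdiff_subset]

instance : MeasurableSingletonClass (SimpleGraph V) := ⟨measurableSet_singleton_graph⟩

section Tails

variable (p : unitInterval)

lemma degree_lower_tail (a : V) (d : ℕ) :
    (SimpleGraph.binomialRandom V p).real {G | (nb G a).card ≤ d}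
      ≤ 2 ^ d * (1 - p / 2) ^ (Fintype.card V - 1) := by
  refine (measureReal_mono ?_).trans
    (lower_tail p a (fun _ => Finset.univ.erase a) (by simp) (by simp) (Fintype.card V - 1) d)
  intro G hG
  refine ⟨by simp, le_trans (Finset.card_le_card ?_) hG⟩
  intro x hx
  exact mem_nb.2 (Finset.mem_filter.1 hx).2

lemma degree_upper_tail (a : V) (d : ℕ) :
    (SimpleGraph.binomialRandom V p).real {G | d ≤ (nb G a).card}
      ≤ (1 / 2) ^ d * (1 + p) ^ (Fintype.card V - 1) := by
  refine (measureReal_mono ?_).trans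
    (upper_tail p a (fun _ => Finset.univ.erase a) (by simp) (by simp) (Fintype.card V - 1) d)
  intro G hG
  refine ⟨by simp, le_trans hG (Finset.card_le_card ?_)⟩
  intro x hx
  rw [mem_nb] at hx
  simp [hx, hx.ne']

lemma nb_erase_rewire {a b : V} (hab : a ≠ b) (G : SimpleGraph V) (f : V → Finset V) :
    (nb (rewire G {a} ((nb G b).erase a) f) b).erase a = (nb G b).erase a := by
  rw [nb_rewire (by simpa using hab.symm) (by simp)]

lemma filter_nb_erase (G : SimpleGraph V) (a b : V) :
    {x ∈ (nb G b).erase a | G.Adj a x} = {x ∈ nb G b | G.Adj a x} := by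
  ext x
  have : G.Adj a x → x ≠ a := fun h => h.ne'
  simp only [Finset.mem_filter, Finset.mem_erase]
  tauto

lemma codegree_upper_tail {a b : V} (hab : a ≠ b) (s D : ℕ) :
    (SimpleGraph.binomialRandom V p).real
      {G | (nb G b).card ≤ s ∧ D ≤ Finset.card {x ∈ nb G b | G.Adj a x}}
      ≤ (1 / 2) ^ D * (1 + p) ^ s := by
  refine (measureReal_mono ?_).trans
    (upper_tail p a (fun G => (nb G b).erase a) (by simp) (fun G f _ => nb_erase_rewire hab G f)
      s D)
  rintro G ⟨h1, h2⟩
  exact ⟨(Finset.card_erase_le).trans h1, by rwa [filter_nb_erase]⟩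

lemma codegree_lower_tail {a b : V} (hab : a ≠ b) (s d : ℕ) :
    (SimpleGraph.binomialRandom V p).real
      {G | s + 1 ≤ (nb G b).card ∧ Finset.card {x ∈ nb G b | G.Adj a x} ≤ d}
      ≤ 2 ^ d * (1 - p / 2) ^ s := by
  refine (measureReal_mono ?_).trans
    (lower_tail p a (fun G => (nb G b).erase a) (by simp) (fun G f _ => nb_erase_rewire hab G f)
      s d)
  rintro G ⟨h1, h2⟩
  exact ⟨(Nat.le_sub_one_of_lt h1).trans Finset.pred_card_le_card_erase,
    by rwa [filter_nb_erase]⟩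

/-- When `a` is not adjacent to `v`, no middle vertex of a walk of length two from `v` is `a` or
lies in `secondNb v a G`, so the set does not see the edges being resampled. The adjacent case is
trivial, the set being empty. -/
lemma secondNb_rewire {v a : V} (hva : v ≠ a) (G : SimpleGraph V) (f : V → Finset V) :
    secondNb v a (rewire G {a} (secondNb v a G) f) = secondNb v a G := by
  have hv : v ∉ secondNb v a G := by
    rw [secondNb]
    split_ifs <;> simp
  have hnb := nb_rewire (G := G) (A := {a}) (by simpa using hva) hv f
  have hadj : (rewire G {a} (secondNb v a G) f).Adj v a ↔ G.Adj v a := by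
    rw [← mem_nb, hnb, mem_nb]
  by_cases h : G.Adj v a
  · rw [secondNb, if_pos (hadj.2 h), secondNb, if_pos h]
  · have htgt : tgt true (rewire G {a} (secondNb v a G) f) v = tgt true G v := by
      refine tgt_rewire (by simpa using hva) hv (fun _ b hb => ⟨?_, ?_⟩) f
      · rw [Finset.mem_singleton]
        rintro rfl
        exact h (mem_nb.1 hb)
      · simp only [secondNb, if_neg h, Finset.mem_sdiff, Finset.mem_union]
        tauto
    rw [secondNb, if_neg (hadj.not.2 h), htgt, hnb, secondNb, if_neg h]

lemma secondNb_upper_tail {v a : V} (hva : v ≠ a) (s D : ℕ) :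
    (SimpleGraph.binomialRandom V p).real
      {G | (secondNb v a G).card ≤ s ∧ D ≤ Finset.card {x ∈ secondNb v a G | G.Adj a x}}
      ≤ (1 / 2) ^ D * (1 + p) ^ s := by
  refine upper_tail p a (secondNb v a) (fun G => ?_) (fun G f _ => secondNb_rewire hva G f) s D
  rw [secondNb]
  split_ifs <;> simp

end Tails

lemma measureReal_iUnion_le_card_mul (p : unitInterval) {ι : Type*} [Fintype ι]
    (s : ι → Set (SimpleGraph V)) (ε : ℝ)
    (h : ∀ i, (SimpleGraph.binomialRandom V p).real (s i) ≤ ε) :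
    (SimpleGraph.binomialRandom V p).real (⋃ i, s i) ≤ Fintype.card ι * ε := by
  refine (measureReal_iUnion_fintype_le s).trans ((Finset.sum_le_sum fun i _ => h i).trans ?_)
  rw [Finset.sum_const, Finset.card_univ, nsmul_eq_mul]

/-- A bound for the probability that an event holding for some tuple of distinct vertices occurs. -/
lemma measureReal_imp_le (p : unitInterval) {ι : Type*} [Fintype ι] (c : ι → Prop)
    (s : ι → Set (SimpleGraph V)) (ε : ℝ) (hε : 0 ≤ ε)
    (h : ∀ i, c i → (SimpleGraph.binomialRandom V p).real (s i) ≤ ε) :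
    (SimpleGraph.binomialRandom V p).real {G | ∃ i, c i ∧ G ∈ s i} ≤ Fintype.card ι * ε := by
  have : {G | ∃ i, c i ∧ G ∈ s i} = ⋃ i, {G | c i ∧ G ∈ s i} := by ext; simp
  rw [this]
  refine measureReal_iUnion_le_card_mul p _ ε fun i => ?_
  by_cases hc : c i
  · simpa [hc] using h i hc
  · simpa [hc] using hε

end GoodGraphs
-- Union bounds for the failure probability.
section Bounds
open scoped Classical
open MeasureTheory

set_option linter.unusedSectionVars false

variable {V : Type*} [Fintype V]

/-- The terms account for a low degree, a high degree, a large codegree, a collision and the extra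
exceptional event `T`. `T` is empty for first neighbourhoods; for second neighbourhoods it says that
some vertex has many neighbours in a `secondNb`. -/
theorem binomialRandom_real_not_isReconstructible_le (p : unitInterval) (j : Bool)
    (dmin dmax C m N : ℕ) (T : Set (SimpleGraph V)) (ε : ℝ) (hε : 0 ≤ ε)
    (hample : ∀ G, G ∉ T → (∀ w, dmin ≤ (nb G w).card) → (∀ w, (nb G w).card ≤ dmax) →
      (∀ a b, a ≠ b → Finset.card {x ∈ nb G b | G.Adj a x} ≤ C) →
      ∀ u v u' v', u ≠ v → u ≠ u' → u ≠ v' → Ample j m N u v u' v' G)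
    (h : ∀ (A X : Finset V) (t : ℕ → ℕ), N ≤ A.card → X.card = m →
      ∑ f ∈ choices A X, (if ∀ l, Finset.card {a ∈ A | (f a).card = l} = t l
        then ∏ a ∈ A, subsetWeight (p : ℝ) X (f a) else 0) ≤ ε) :
    (SimpleGraph.binomialRandom V p).real {G | ¬ IsReconstructible 2 G} ≤
      Fintype.card V * (2 ^ dmin * (1 - p / 2) ^ (Fintype.card V - 1)) +
      Fintype.card V * ((1 / 2) ^ dmax * (1 + p) ^ (Fintype.card V - 1)) +
      Fintype.card V ^ 2 * ((1 / 2) ^ C * (1 + p) ^ dmax) +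
      Fintype.card V ^ 4 * ε + (SimpleGraph.binomialRandom V p).real T := by
  have hp := p.2.1
  have hp' := p.2.2
  set n := Fintype.card V
  have hsub : {G : SimpleGraph V | ¬ IsReconstructible 2 G} ⊆
      ((({G | ∃ w, True ∧ G ∈ {G | (nb G w).card ≤ dmin}} ∪
      {G | ∃ w, True ∧ G ∈ {G | dmax ≤ (nb G w).card}}) ∪
      {G | ∃ q : V × V, q.1 ≠ q.2 ∧ G ∈ {G | (nb G q.2).card ≤ dmax ∧
        C ≤ Finset.card {x ∈ nb G q.2 | G.Adj q.1 x}}}) ∪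
      {G | ∃ q : (V × V) × (V × V), (q.1.1 ≠ q.1.2 ∧ q.1.1 ≠ q.2.1 ∧ q.1.1 ≠ q.2.2) ∧
        G ∈ {G | Ample j m N q.1.1 q.1.2 q.2.1 q.2.2 G ∧
          ∀ k, profile j G q.1.1 q.1.2 k = profile j G q.2.1 q.2.2 k}}) ∪ T := by
    intro G hG
    by_contra hcon
    simp only [Set.mem_union, Set.mem_ofPred_eq, not_or, true_and, not_exists, not_and, not_le,
      Prod.forall] at hcon
    obtain ⟨⟨⟨⟨h1, h2⟩, h3⟩, h4⟩, h5⟩ := hcon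
    refine hG (isReconstructible_of_profile j fun u v u' v' huv _ huu' huv' => ?_)
    have := h4 u v u' v' ⟨huv.ne, huu', huv'⟩ (hample G h5 (fun w => (h1 w).le) (fun w => (h2 w).le)
      (fun a b hab => (h3 a b hab (h2 b).le).le) u v u' v' huv.ne huu' huv')
    push Not at this
    exact this
  have e1 := measureReal_imp_le p (fun _ : V => True) (fun w => {G | (nb G w).card ≤ dmin})
    (2 ^ dmin * (1 - p / 2) ^ (n - 1)) (mul_nonneg (by positivity) (pow_nonneg (by linarith) _))
    (fun w _ => degree_lower_tail p w dmin)
  have e2 := measureReal_imp_le p (fun _ : V => True) (fun w => {G | dmax ≤ (nb G w).card})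
    ((1 / 2) ^ dmax * (1 + p) ^ (n - 1)) (by positivity) (fun w _ => degree_upper_tail p w dmax)
  have e3 := measureReal_imp_le p (fun q : V × V => q.1 ≠ q.2)
    (fun q => {G | (nb G q.2).card ≤ dmax ∧ C ≤ Finset.card {x ∈ nb G q.2 | G.Adj q.1 x}})
    ((1 / 2) ^ C * (1 + p) ^ dmax) (by positivity)
    (fun q hq => codegree_upper_tail p hq dmax C)
  have e4 := measureReal_imp_le p
    (fun q : (V × V) × (V × V) => q.1.1 ≠ q.1.2 ∧ q.1.1 ≠ q.2.1 ∧ q.1.1 ≠ q.2.2)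
    (fun q => {G | Ample j m N q.1.1 q.1.2 q.2.1 q.2.2 G ∧
          ∀ k, profile j G q.1.1 q.1.2 k = profile j G q.2.1 q.2.2 k}) ε hε
    (fun q _ => binomialRandom_real_collision_le p j m N q.1.1 q.1.2 q.2.1 q.2.2 ε hε h)
  rw [Fintype.card_prod] at e3
  rw [Fintype.card_prod, Fintype.card_prod] at e4
  have hsq : ((n * n : ℕ) : ℝ) = (n : ℝ) ^ 2 := by push_cast; ring
  have hfour : ((n * n * (n * n) : ℕ) : ℝ) = (n : ℝ) ^ 4 := by push_cast; ring
  rw [hsq] at e3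
  rw [hfour] at e4
  refine (measureReal_mono hsub).trans ((measureReal_union_le _ _).trans (add_le_add_left ?_ _))
  refine (measureReal_union_le _ _).trans (add_le_add ?_ e4)
  refine (measureReal_union_le _ _).trans (add_le_add ?_ e3)
  exact (measureReal_union_le _ _).trans (add_le_add e1 e2)

/-- Failure probability when profiles count neighbours in the first neighbourhood. -/
theorem not_isReconstructible_le_of_first (p : unitInterval) (dmin dmax C m N : ℕ) (ε : ℝ)
    (hε : 0 ≤ ε) (hN : (C + 1) * N + (3 * C + 3) ≤ dmin) (hm : m + C + 4 ≤ dmin)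
    (h : ∀ (A X : Finset V) (t : ℕ → ℕ), N ≤ A.card → X.card = m →
      ∑ f ∈ choices A X, (if ∀ l, Finset.card {a ∈ A | (f a).card = l} = t l
        then ∏ a ∈ A, subsetWeight (p : ℝ) X (f a) else 0) ≤ ε) :
    (SimpleGraph.binomialRandom V p).real {G | ¬ IsReconstructible 2 G} ≤
      Fintype.card V * (2 ^ dmin * (1 - p / 2) ^ (Fintype.card V - 1)) +
      Fintype.card V * ((1 / 2) ^ dmax * (1 + p) ^ (Fintype.card V - 1)) +
      Fintype.card V ^ 2 * ((1 / 2) ^ C * (1 + p) ^ dmax) + Fintype.card V ^ 4 * ε := by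
  have := binomialRandom_real_not_isReconstructible_le p false dmin dmax C m N ∅ ε hε
    (fun G _ h1 _ h3 u v u' v' huv huu' huv' => ample_false h1 h3 huv huu' huv' hN hm) h
  simpa using this

/-- Failure probability when profiles count neighbours in the second neighbourhood. -/
theorem not_isReconstructible_le_of_second (p : unitInterval) (dmin dmax C D m N : ℕ) (ε : ℝ)
    (hε : 0 ≤ ε) (hC0 : 0 < C) (hN : (D + C + 3) * N + (3 * C + 3) ≤ dmin)
    (hm : (m + 4 * dmax + 4) * C ≤ dmin * (dmin - 1))
    (h : ∀ (A X : Finset V) (t : ℕ → ℕ), N ≤ A.card → X.card = m →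
      ∑ f ∈ choices A X, (if ∀ l, Finset.card {a ∈ A | (f a).card = l} = t l
        then ∏ a ∈ A, subsetWeight (p : ℝ) X (f a) else 0) ≤ ε) :
    (SimpleGraph.binomialRandom V p).real {G | ¬ IsReconstructible 2 G} ≤
      Fintype.card V * (2 ^ dmin * (1 - p / 2) ^ (Fintype.card V - 1)) +
      Fintype.card V * ((1 / 2) ^ dmax * (1 + p) ^ (Fintype.card V - 1)) +
      Fintype.card V ^ 2 * ((1 / 2) ^ C * (1 + p) ^ dmax) + Fintype.card V ^ 4 * ε +
      Fintype.card V ^ 2 * ((1 / 2) ^ D * (1 + p) ^ dmax ^ 2) := by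
  have hp := p.2.1
  set T₂ : Set (SimpleGraph V) := {G | ∃ q : V × V, q.1 ≠ q.2 ∧
    G ∈ {G | (secondNb q.1 q.2 G).card ≤ dmax ^ 2 ∧
      D ≤ Finset.card {x ∈ secondNb q.1 q.2 G | G.Adj q.2 x}}} with hT₂
  have := binomialRandom_real_not_isReconstructible_le p true dmin dmax C m N T₂ ε hε ?_ h
  · have e2 := measureReal_imp_le p (fun q : V × V => q.1 ≠ q.2)
      (fun q => {G | (secondNb q.1 q.2 G).card ≤ dmax ^ 2 ∧
        D ≤ Finset.card {x ∈ secondNb q.1 q.2 G | G.Adj q.2 x}})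
      ((1 / 2) ^ D * (1 + p) ^ dmax ^ 2) (by positivity)
      (fun q hq => secondNb_upper_tail p hq _ D)
    rw [Fintype.card_prod, show ((Fintype.card V * Fintype.card V : ℕ) : ℝ)
      = (Fintype.card V : ℝ) ^ 2 by push_cast; ring] at e2
    linarith
  · intro G hG h1 h2 h3 u v u' v' huv huu' huv'
    refine ample_true h1 h2 h3 (fun v a hva => ?_) huv huu' huv' hC0 hN hm
    by_contra hcon
    exact hG ⟨(v, a), hva, card_secondNb_le h2 v a, (not_le.1 hcon).le⟩

/-- Failure probability when the diameter is at most two. -/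
theorem not_isReconstructible_le_of_dense [Nonempty V] (p : unitInterval) (dmin : ℕ) :
    (SimpleGraph.binomialRandom V p).real {G | ¬ IsReconstructible 2 G} ≤
      Fintype.card V * (2 ^ dmin * (1 - p / 2) ^ (Fintype.card V - 1)) +
      Fintype.card V ^ 2 * (1 - p / 2) ^ dmin := by
  have hp := p.2.1
  have hp' := p.2.2
  have h0 : 0 ≤ 1 - (p : ℝ) / 2 := by linarith
  have hsub : {G : SimpleGraph V | ¬ IsReconstructible 2 G} ⊆
      {G | ∃ w, True ∧ G ∈ {G | (nb G w).card ≤ dmin}} ∪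
      {G | ∃ q : V × V, q.1 ≠ q.2 ∧ G ∈ {G | dmin + 1 ≤ (nb G q.2).card ∧
        Finset.card {x ∈ nb G q.2 | G.Adj q.1 x} ≤ 0}} := by
    intro G hG
    by_contra hcon
    simp only [Set.mem_union, Set.mem_ofPred_eq, not_or, true_and, not_exists, not_and, not_le,
      Prod.forall] at hcon
    obtain ⟨h1, h2⟩ := hcon
    obtain ⟨v⟩ := ‹Nonempty V›
    refine hG (isReconstructible_of_ballSet_eq_univ v fun w => ?_)
    by_cases hvw : v = w
    · subst hvw
      exact (center G 2 v).2
    · obtain ⟨x, hx⟩ := Finset.card_pos.1 (h2 v w hvw (h1 w))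
      rw [Finset.mem_filter, mem_nb] at hx
      exact mem_ballSet_of_adj_adj hx.2 hx.1.symm
  have e1 := measureReal_imp_le p (fun _ : V => True) (fun w => {G | (nb G w).card ≤ dmin})
    (2 ^ dmin * (1 - p / 2) ^ (Fintype.card V - 1))
    (mul_nonneg (by positivity) (pow_nonneg h0 _))
    (fun w _ => degree_lower_tail p w dmin)
  have e2 := measureReal_imp_le p (fun q : V × V => q.1 ≠ q.2)
    (fun q => {G | dmin + 1 ≤ (nb G q.2).card ∧ Finset.card {x ∈ nb G q.2 | G.Adj q.1 x} ≤ 0})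
    ((1 - p / 2) ^ dmin) (pow_nonneg h0 _)
    (fun q hq => by simpa using codegree_lower_tail p hq dmin 0)
  rw [Fintype.card_prod, show ((Fintype.card V * Fintype.card V : ℕ) : ℝ)
      = (Fintype.card V : ℝ) ^ 2 by push_cast; ring] at e2
  exact (measureReal_mono hsub).trans ((measureReal_union_le _ _).trans (add_le_add e1 e2))

end Bounds
-- Asymptotic estimates and the choice of the number of levels.
section Asymptotics
open scoped Classical

lemma eventually_mul_rpow_le {a b : ℝ} (hab : a < b) (c : ℝ) :
    ∀ᶠ n : ℕ in atTop, c * (n : ℝ) ^ a ≤ (n : ℝ) ^ b := by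
  have h1 : Tendsto (fun n : ℕ => (n : ℝ) ^ (b - a)) atTop atTop :=
    (tendsto_rpow_atTop (sub_pos.2 hab)).comp tendsto_natCast_atTop_atTop
  filter_upwards [h1.eventually_ge_atTop c, eventually_gt_atTop 0] with n hn hpos
  have hpos' : (0 : ℝ) < n := by exact_mod_cast hpos
  calc c * (n : ℝ) ^ a ≤ (n : ℝ) ^ (b - a) * (n : ℝ) ^ a :=
        mul_le_mul_of_nonneg_right hn (by positivity)
    _ = (n : ℝ) ^ b := by rw [← Real.rpow_add hpos', sub_add_cancel]

lemma eventually_le_rpow {b : ℝ} (hb : 0 < b) (c : ℝ) : ∀ᶠ n : ℕ in atTop, c ≤ (n : ℝ) ^ b := by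
  simpa using eventually_mul_rpow_le hb c

lemma eventually_exp_neg_le {a c : ℝ} (ha : 0 < a) (hc : 0 < c) (s : ℝ) :
    ∀ᶠ n : ℕ in atTop, Real.exp (-(a * (n : ℝ) ^ c)) ≤ (n : ℝ) ^ (-s) := by
  have h1 : Tendsto (fun n : ℕ => (n : ℝ) ^ c) atTop atTop :=
    (tendsto_rpow_atTop hc).comp tendsto_natCast_atTop_atTop
  have h2 := (tendsto_rpow_mul_exp_neg_mul_atTop_nhds_zero (s / c) a ha).comp h1
  filter_upwards [h2.eventually_le_const zero_lt_one, eventually_gt_atTop 0] with n hn hpos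
  have hpos' : (0 : ℝ) < n := by exact_mod_cast hpos
  simp only [Function.comp] at hn
  rw [← Real.rpow_mul hpos'.le, mul_div_cancel₀ _ hc.ne', neg_mul] at hn
  rw [Real.rpow_neg hpos'.le, ← one_div, le_div_iff₀ (by positivity), mul_comm]
  exact hn

lemma half_pow_mul_le (p : unitInterval) (a b : ℕ) :
    (1 / 2 : ℝ) ^ a * (1 + p) ^ b ≤ Real.exp (p * b - 2 / 3 * a) := by
  have h1 : (1 / 2 : ℝ) ≤ Real.exp (-(2 / 3)) := by
    rw [← Real.exp_log (show (0 : ℝ) < 1 / 2 by norm_num), Real.exp_le_exp, one_div, Real.log_inv]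
    linarith [Real.log_two_gt_d9]
  have h2 : (1 + p : ℝ) ≤ Real.exp p := by linarith [Real.add_one_le_exp (p : ℝ)]
  have hp := p.2.1
  calc (1 / 2 : ℝ) ^ a * (1 + p) ^ b ≤ Real.exp (-(2 / 3)) ^ a * Real.exp p ^ b :=
        mul_le_mul (pow_le_pow_left₀ (by norm_num) h1 _) (pow_le_pow_left₀ (by linarith) h2 _)
          (by positivity) (by positivity)
    _ = _ := by
        rw [← Real.exp_nat_mul, ← Real.exp_nat_mul, ← Real.exp_add]
        ring_nf

lemma one_sub_half_pow_le (p : unitInterval) (b : ℕ) :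
    (1 - p / 2 : ℝ) ^ b ≤ Real.exp (-(p * b / 2)) := by
  have hp := p.2.1
  have hp' := p.2.2
  have h2 : (1 - p / 2 : ℝ) ≤ Real.exp (-(p / 2)) := by
    linarith [Real.add_one_le_exp (-(p / 2 : ℝ))]
  calc (1 - p / 2 : ℝ) ^ b ≤ Real.exp (-(p / 2)) ^ b := pow_le_pow_left₀ (by linarith) h2 _
    _ = _ := by
        rw [← Real.exp_nat_mul]
        ring_nf

lemma two_pow_mul_le (p : unitInterval) (a b : ℕ) :
    (2 : ℝ) ^ a * (1 - p / 2) ^ b ≤ Real.exp (a - p * b / 2) := by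
  have h1 : (2 : ℝ) ≤ Real.exp 1 := by linarith [Real.add_one_le_exp (1 : ℝ)]
  have hp' := p.2.2
  calc (2 : ℝ) ^ a * (1 - p / 2) ^ b ≤ Real.exp 1 ^ a * Real.exp (-(p * b / 2)) :=
        mul_le_mul (pow_le_pow_left₀ (by norm_num) h1 _) (one_sub_half_pow_le p b)
          (pow_nonneg (by linarith) _) (by positivity)
    _ = _ := by
        rw [← Real.exp_nat_mul, ← Real.exp_add]
        ring_nf

/-- By Bernoulli's inequality level `0` alone has mass at least `1 - mp ≥ 1/2`. -/
lemma sum_binomial_succ_le {p : unitInterval} {m K : ℕ} (hK : K ≤ m) (hmp : (m : ℝ) * p ≤ 1 / 2) :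
    ∑ i : Fin K, ((m.choose (i + 1) : ℝ) * (p : ℝ) ^ ((i : ℕ) + 1) * (1 - p) ^ (m - (i + 1)))
      ≤ 1 / 2 := by
  have hp := p.2.1
  have hp' := p.2.2
  set q : ℕ → ℝ := fun l => (m.choose l : ℝ) * (p : ℝ) ^ l * (1 - p) ^ (m - l) with hq
  have hq0 (l : ℕ) : 0 ≤ q l :=
    mul_nonneg (mul_nonneg (Nat.cast_nonneg _) (pow_nonneg hp _)) (pow_nonneg (by linarith) _)
  have h1 : ∑ l ∈ Finset.range (m + 1), q l = 1 := by
    have := add_pow (p : ℝ) (1 - p) m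
    rw [add_sub_cancel, one_pow] at this
    rw [this]
    exact Finset.sum_congr rfl fun l _ => by rw [hq]; ring
  have h2 : 1 / 2 ≤ q 0 := by
    have := one_add_mul_le_pow (show (-2 : ℝ) ≤ -p by linarith) m
    simp only [hq, Nat.choose_zero_right, Nat.cast_one, pow_zero, mul_one, one_mul, Nat.sub_zero]
    rw [sub_eq_add_neg]
    linarith
  have h3 : ∑ i : Fin K, q (i + 1) + q 0 ≤ 1 := by
    rw [Fin.sum_univ_eq_sum_range (fun i => q (i + 1)), ← Finset.sum_range_succ', ← h1]
    exact Finset.sum_le_sum_of_subset_of_nonneg (Finset.range_mono (by omega))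
      fun _ _ _ => hq0 _
  linarith

lemma binomial_ge {p : unitInterval} {m K l : ℕ} {x : ℝ} (hl : l ≤ K) (hK : 2 * K ≤ m)
    (hmp : (m : ℝ) * p ≤ 1 / 2) (hx : 0 ≤ x) (hx' : 2 * x ≤ m * p) :
    x ^ K / (2 * K.factorial) ≤ (m.choose l : ℝ) * (p : ℝ) ^ l * (1 - p) ^ (m - l) := by
  have hp := p.2.1
  have hp' := p.2.2
  have h1 : (1 : ℝ) / 2 ≤ (1 - p) ^ (m - l) := by
    have h := one_add_mul_le_pow (show (-2 : ℝ) ≤ -p by linarith) (m - l)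
    have h' : ((m - l : ℕ) : ℝ) * p ≤ m * p :=
      mul_le_mul_of_nonneg_right (by exact_mod_cast Nat.sub_le m l) hp
    rw [sub_eq_add_neg]
    linarith
  have h2 : (m : ℝ) / 2 ≤ ((m + 1 - l : ℕ) : ℝ) := by
    have : m ≤ 2 * (m + 1 - l) := by omega
    have : (m : ℝ) ≤ 2 * ((m + 1 - l : ℕ) : ℝ) := by exact_mod_cast this
    linarith
  have h3 := Nat.pow_le_choose (α := ℝ) l m
  have h4 : x ^ l ≤ (((m + 1 - l : ℕ) : ℝ)) ^ l * (p : ℝ) ^ l := by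
    rw [← mul_pow]
    refine pow_le_pow_left₀ hx ?_ _
    nlinarith
  have h5 : x ^ K ≤ x ^ l := pow_le_pow_of_le_one hx (by linarith) hl
  have h6 : (l.factorial : ℝ) ≤ K.factorial := by exact_mod_cast Nat.factorial_le hl
  have h7 : x ^ K / K.factorial ≤ (m.choose l : ℝ) * (p : ℝ) ^ l := by
    calc x ^ K / K.factorial ≤ x ^ l / l.factorial := by
          exact div_le_div₀ (by positivity) h5 (by positivity) h6
      _ ≤ ((m + 1 - l : ℕ) : ℝ) ^ l * (p : ℝ) ^ l / l.factorial := by gcongr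
      _ = ((m + 1 - l : ℕ) : ℝ) ^ l / l.factorial * (p : ℝ) ^ l := by ring
      _ ≤ _ := by gcongr
  calc x ^ K / (2 * K.factorial) = x ^ K / K.factorial * (1 / 2) := by field_simp
    _ ≤ _ := mul_le_mul h7 h1 (by norm_num) (by positivity)

/-- At density `n ^ (-η)` with `η` small in terms of `β`, the sizes of `n ^ β` random sets have a
given distribution with probability at most `n ^ (-6)`. -/
theorem exists_eventually_sum_choices_le {β : ℝ} (hβ : 0 < β) :
    ∃ η : ℝ, 0 < η ∧ η ≤ 1 / 100 ∧ ∀ᶠ n : ℕ in atTop, ∀ p : unitInterval, 0 < (p : ℝ) →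
      (p : ℝ) ≤ (n : ℝ) ^ (-(1 / 3) : ℝ) → ∀ (V : Type) [Fintype V] (A X : Finset V) (t : ℕ → ℕ),
        ⌈(n : ℝ) ^ β⌉₊ ≤ A.card → X.card = ⌊(n : ℝ) ^ (-η) / p⌋₊ →
        ∑ f ∈ choices A X, (if ∀ l, Finset.card {a ∈ A | (f a).card = l} = t l
          then ∏ a ∈ A, subsetWeight (p : ℝ) X (f a) else 0) ≤ (n : ℝ) ^ (-6 : ℝ) := by
  -- Each level will gain a factor `n ^ (-β/16)`, so `96 / β` levels give `n ^ (-6)`.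
  obtain ⟨K, hK⟩ := exists_nat_ge (96 / β)
  have hKβ : 96 ≤ K * β := (div_le_iff₀ hβ).1 hK
  have hKpos : (0 : ℝ) < K := by
    by_contra h
    nlinarith [not_lt.1 h]
  -- Level probabilities are of order at least `n ^ (-ηK)`; `ηK ≤ β/4` keeps the expected counts
  -- above `n ^ (β/2)`.
  refine ⟨min (1 / 100) (β / (4 * K)), by positivity, min_le_left _ _, ?_⟩
  set η := min (1 / 100) (β / (4 * K)) with hη
  have hη0 : 0 < η := by positivity
  have hη1 : η ≤ 1 / 100 := min_le_left _ _
  have hηK : η * K ≤ β / 4 := by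
    have : η ≤ β / (4 * K) := min_le_right _ _
    rw [le_div_iff₀ (by positivity)] at this
    linarith
  filter_upwards [eventually_mul_rpow_le (show -(1 / 3) < -η by linarith) 2,
    eventually_mul_rpow_le (show -η < 0 by linarith) 2,
    eventually_le_rpow (show 0 < 1 / 3 - η by linarith) (4 * K),
    eventually_mul_rpow_le (show β / 2 < β - η * K by linarith) (4 ^ K * (2 * K.factorial)),
    eventually_exp_neg_le (show (0 : ℝ) < 4 by norm_num) (show 0 < β / 4 by linarith) (β / 8),
    eventually_mul_rpow_le (show -(β / 8) < -(β / 16) by linarith) 4,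
    eventually_gt_atTop 0] with n h1 h2 h3 h4 h5 h6 hn p hp0 hp V _ A X t hA hX
  have hn' : (1 : ℝ) ≤ n := by exact_mod_cast hn
  have hnpos : (0 : ℝ) < n := by linarith
  rw [Real.rpow_zero] at h2
  set m := ⌊(n : ℝ) ^ (-η) / p⌋₊ with hm
  have hmp : (m : ℝ) * p ≤ (n : ℝ) ^ (-η) := by
    rw [← le_div_iff₀ hp0]
    exact Nat.floor_le (by positivity)
  have hmp' : (n : ℝ) ^ (-η) / 2 ≤ (m : ℝ) * p := by
    have h := Nat.lt_floor_add_one ((n : ℝ) ^ (-η) / p)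
    rw [div_lt_iff₀ hp0, add_mul, one_mul] at h
    linarith
  have hmhalf : (m : ℝ) * p ≤ 1 / 2 := by linarith
  have hKm : 2 * K ≤ m := by
    have h7 : (m : ℝ) * (n : ℝ) ^ (-(1 / 3) : ℝ) ≥ (n : ℝ) ^ (-η) / 2 :=
      hmp'.trans (mul_le_mul_of_nonneg_left hp (Nat.cast_nonneg _))
    have h8 : (n : ℝ) ^ (1 / 3 - η) * (n : ℝ) ^ (-(1 / 3) : ℝ) = (n : ℝ) ^ (-η) := by
      rw [← Real.rpow_add hnpos]
      ring_nf
    have h9 : (0 : ℝ) < (n : ℝ) ^ (-(1 / 3) : ℝ) := by positivity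
    have h10 : (2 * K : ℝ) ≤ m := by
      by_contra hcon
      nlinarith [not_le.1 hcon]
    exact_mod_cast h10
  have hAn : (n : ℝ) ^ β ≤ A.card := (Nat.le_ceil _).trans (by exact_mod_cast hA)
  have hLq (i : Fin K) : (n : ℝ) ^ (β / 2) ≤ A.card * ((X.card.choose (i + 1) : ℝ) *
      (p : ℝ) ^ ((i : ℕ) + 1) * (1 - p) ^ (X.card - (i + 1))) := by
    have h7 := binomial_ge (p := p) (m := m) (K := K) (l := i + 1) (x := (n : ℝ) ^ (-η) / 4)
      i.2 hKm hmhalf (by positivity) (by linarith)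
    rw [hX]
    refine le_trans ?_ (mul_le_mul hAn h7 (by positivity) (by positivity))
    have h8 : (n : ℝ) ^ β * (((n : ℝ) ^ (-η) / 4) ^ K / (2 * K.factorial))
        = (n : ℝ) ^ (β - η * K) / (4 ^ K * (2 * K.factorial)) := by
      rw [div_pow, ← Real.rpow_natCast ((n : ℝ) ^ (-η)), ← Real.rpow_mul hnpos.le, sub_eq_add_neg,
        Real.rpow_add hnpos, neg_mul]
      field_simp
    rw [h8, le_div_iff₀ (by positivity), mul_comm]
    exact h4
  -- With `L = n ^ (β/2)` and `τ = n ^ (-β/8)`, `Lτ²` is a positive power of `n`, and the three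
  -- terms of the base add up to at most `4 n ^ (-β/8)`.
  refine (sum_choices_card_eq_le p A X K t _ (fun l => rfl) ?_ ((n : ℝ) ^ (β / 2))
    ((n : ℝ) ^ (-(β / 8))) (by positivity) (by positivity) hLq).trans ?_
  · rw [hX]
    exact sum_binomial_succ_le (by omega) hmhalf
  have h7 : (n : ℝ) ^ (β / 2) * ((n : ℝ) ^ (-(β / 8))) ^ 2 = (n : ℝ) ^ (β / 4) := by
    rw [← Real.rpow_natCast ((n : ℝ) ^ (-(β / 8))), ← Real.rpow_mul hnpos.le,
      ← Real.rpow_add hnpos]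
    congr 1
    push_cast
    ring
  have h8 : 1 / ((A.card : ℝ) + 1) ≤ (n : ℝ) ^ (-(β / 8)) := by
    rw [Real.rpow_neg hnpos.le, ← one_div]
    refine one_div_le_one_div_of_le (by positivity) ?_
    have : (n : ℝ) ^ (β / 8) ≤ (n : ℝ) ^ β := Real.rpow_le_rpow_of_exponent_le hn' (by linarith)
    linarith
  have h9 : Real.exp (-(4 * (n : ℝ) ^ (β / 2) * ((n : ℝ) ^ (-(β / 8))) ^ 2))
      ≤ (n : ℝ) ^ (-(β / 8)) := by
    rw [mul_assoc, h7]
    exact h5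
  calc _ ≤ ((n : ℝ) ^ (-(β / 16))) ^ K := by
        refine pow_le_pow_left₀ (by positivity) ?_ _
        linarith
    _ = (n : ℝ) ^ (-(β / 16) * K) := by
        rw [← Real.rpow_natCast ((n : ℝ) ^ (-(β / 16))), ← Real.rpow_mul hnpos.le]
    _ ≤ _ := Real.rpow_le_rpow_of_exponent_le hn' (by linarith)

end Asymptotics
-- The three ranges of `p` and the final limit.
section Regimes
open scoped Classical

lemma natCast_mul_lower_degree_le {n : ℕ} (hn : 2 ≤ n) (p : unitInterval) {c : ℝ}
    (hx : c ≤ n * p) :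
    (n : ℝ) * (2 ^ ⌊(n : ℝ) * p / 8⌋₊ * (1 - p / 2) ^ (n - 1)) ≤ n * Real.exp (-(c / 8)) := by
  have hp := p.2.1
  refine mul_le_mul_of_nonneg_left ((two_pow_mul_le p _ _).trans (Real.exp_le_exp.2 ?_))
    (Nat.cast_nonneg _)
  have h1 : (⌊(n : ℝ) * p / 8⌋₊ : ℝ) ≤ n * p / 8 := Nat.floor_le (by positivity)
  have h2 : (2 : ℝ) ≤ n := by exact_mod_cast hn
  rw [Nat.cast_sub (by omega), Nat.cast_one]
  nlinarith

lemma natCast_mul_upper_degree_le (n : ℕ) (p : unitInterval) {c : ℝ}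
    (hx : c ≤ n * p) :
    (n : ℝ) * ((1 / 2) ^ ⌈4 * ((n : ℝ) * p)⌉₊ * (1 + p) ^ (n - 1)) ≤ n * Real.exp (-(c / 8)) := by
  have hp := p.2.1
  refine mul_le_mul_of_nonneg_left ((half_pow_mul_le p _ _).trans (Real.exp_le_exp.2 ?_))
    (Nat.cast_nonneg _)
  have h1 := Nat.le_ceil (4 * ((n : ℝ) * p))
  have h2 : ((n - 1 : ℕ) : ℝ) ≤ n := by exact_mod_cast Nat.sub_le n 1
  have h3 : 0 ≤ (n : ℝ) * p := by positivity
  nlinarith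

lemma sq_mul_upper_le (n : ℕ) (p : unitInterval) {c : ℝ} {a b : ℕ} (hx : (p : ℝ) * b + c ≤ 2 / 3 * a) :
    (n : ℝ) ^ 2 * ((1 / 2) ^ a * (1 + p) ^ b) ≤ n ^ 2 * Real.exp (-c) := by
  refine mul_le_mul_of_nonneg_left ((half_pow_mul_le p _ _).trans (Real.exp_le_exp.2 ?_))
    (by positivity)
  linarith

/-- At most five error terms are added in each range, so `1 / (5n)` apiece is enough for a total of
`1 / n`. -/
lemma rpow_neg_six_bounds {n : ℕ} (hn : 5 ≤ n) {e : ℝ} (he : e ≤ (n : ℝ) ^ (-6 : ℝ)) :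
    (n : ℝ) * e ≤ 1 / (5 * n) ∧ (n : ℝ) ^ 2 * e ≤ 1 / (5 * n) ∧ (n : ℝ) ^ 4 * e ≤ 1 / (5 * n) := by
  have h5 : (5 : ℝ) ≤ n := by exact_mod_cast hn
  have hpos : (0 : ℝ) < n := by linarith
  have h1 : (n : ℝ) ^ (-6 : ℝ) = 1 / (n : ℝ) ^ 6 := by
    rw [Real.rpow_neg hpos.le, ← one_div]
    norm_cast
  rw [h1] at he
  have h4 : (n : ℝ) ^ 4 * e ≤ 1 / (5 * n) := by
    calc (n : ℝ) ^ 4 * e ≤ (n : ℝ) ^ 4 * (1 / (n : ℝ) ^ 6) := by gcongr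
      _ = 1 / ((n : ℝ) * n) := by field_simp
      _ ≤ 1 / (5 * (n : ℝ)) := one_div_le_one_div_of_le (by positivity) (by gcongr)
  have h0 : 0 ≤ 1 / (5 * (n : ℝ)) := by positivity
  by_cases hpe : 0 ≤ e
  · refine ⟨le_trans (mul_le_mul_of_nonneg_right ?_ hpe) h4,
      le_trans (mul_le_mul_of_nonneg_right ?_ hpe) h4, h4⟩
    · exact le_self_pow₀ (by linarith) (by norm_num)
    · exact pow_le_pow_right₀ (by linarith) (by norm_num)
  · rw [not_le] at hpe
    exact ⟨by nlinarith, by nlinarith [sq_nonneg (n : ℝ)], h4⟩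

/-- Here `np² ≥ n ^ (1/50)`, so every two vertices have a common neighbour. -/
theorem eventually_not_isReconstructible_le_of_dense :
    ∀ᶠ n : ℕ in atTop, ∀ p : unitInterval, (n : ℝ) ^ (-(1 / 2) + 1 / 100 : ℝ) ≤ p →
      (SimpleGraph.binomialRandom (Fin n) p).real {G | ¬ IsReconstructible 2 G} ≤ 1 / n := by
  filter_upwards [eventually_exp_neg_le (show (0 : ℝ) < 1 / 8 by norm_num)
      (show (0 : ℝ) < 1 / 2 + 1 / 100 by norm_num) 6,
    eventually_exp_neg_le (show (0 : ℝ) < 1 / 32 by norm_num)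
      (show (0 : ℝ) < 1 / 50 by norm_num) 6,
    eventually_le_rpow (show (0 : ℝ) < 1 / 50 by norm_num) 16,
    eventually_ge_atTop 5] with n h1 h2 h3 hn p hp
  have hn' : (5 : ℝ) ≤ n := by exact_mod_cast hn
  have hpos : (0 : ℝ) < n := by linarith
  have hp0 := p.2.1
  have hp1 := p.2.2
  have : Nonempty (Fin n) := ⟨⟨0, by omega⟩⟩
  have hx : (n : ℝ) ^ (1 / 2 + 1 / 100 : ℝ) ≤ n * p := by
    calc (n : ℝ) ^ (1 / 2 + 1 / 100 : ℝ) = n * (n : ℝ) ^ (-(1 / 2) + 1 / 100 : ℝ) := by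
          rw [← Real.rpow_one_add' hpos.le (by norm_num)]
          norm_num
      _ ≤ _ := by gcongr
  have hxp : (n : ℝ) ^ (1 / 50 : ℝ) ≤ n * p * p := by
    calc (n : ℝ) ^ (1 / 50 : ℝ)
          = (n : ℝ) ^ (1 / 2 + 1 / 100 : ℝ) * (n : ℝ) ^ (-(1 / 2) + 1 / 100 : ℝ) := by
          rw [← Real.rpow_add hpos]
          norm_num
      _ ≤ _ := by gcongr
  have hmain := not_isReconstructible_le_of_dense (V := Fin n) p ⌊(n : ℝ) * p / 8⌋₊
  rw [Fintype.card_fin] at hmain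
  have e1 := natCast_mul_lower_degree_le (by omega : 2 ≤ n) p hx
  have e2 : (1 - p / 2 : ℝ) ^ ⌊(n : ℝ) * p / 8⌋₊
      ≤ Real.exp (-(1 / 32 * (n : ℝ) ^ (1 / 50 : ℝ))) := by
    refine (one_sub_half_pow_le p _).trans (Real.exp_le_exp.2 ?_)
    have := Nat.lt_floor_add_one ((n : ℝ) * p / 8)
    nlinarith
  have b1 := (rpow_neg_six_bounds hn h1).1
  have b2 := (rpow_neg_six_bounds hn (e2.trans h2)).2.1
  rw [show -(1 / 8 * (n : ℝ) ^ (1 / 2 + 1 / 100 : ℝ)) = -((n : ℝ) ^ (1 / 2 + 1 / 100 : ℝ) / 8)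
    by ring] at b1
  refine hmain.trans ?_
  have : 1 / (5 * (n : ℝ)) = 1 / n / 5 := by field_simp
  have h0 : (0 : ℝ) ≤ 1 / n := by positivity
  linarith

/-- The set `X` must fit into a neighbourhood: `n ^ (-η) / p` should be below a small multiple of
`np`. This still holds slightly below `n ^ (-1/2)`, since `p ≥ n ^ (-1/2 - η/4)` gives `np² ≥ n ^
(-η/2)`. That margin `ε` is what the next range relies on. -/
theorem exists_eventually_not_isReconstructible_le_of_first :
    ∃ ε : ℝ, 0 < ε ∧ ε ≤ 1 / 400 ∧ ∀ᶠ n : ℕ in atTop, ∀ p : unitInterval,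
      (n : ℝ) ^ (-(1 / 2) - ε : ℝ) ≤ p → (p : ℝ) ≤ (n : ℝ) ^ (-(1 / 2) + 1 / 100 : ℝ) →
      (SimpleGraph.binomialRandom (Fin n) p).real {G | ¬ IsReconstructible 2 G} ≤ 1 / n := by
  obtain ⟨η, hη0, hη1, hη⟩ := exists_eventually_sum_choices_le (show (0 : ℝ) < 1 / 3 by norm_num)
  refine ⟨η / 4, by linarith, by linarith, ?_⟩
  filter_upwards [hη,
    eventually_exp_neg_le (show (0 : ℝ) < 1 / 8 by norm_num)
      (show (0 : ℝ) < 49 / 100 by norm_num) 6,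
    eventually_exp_neg_le (show (0 : ℝ) < 1 / 2 by norm_num)
      (show (0 : ℝ) < 1 / 10 by norm_num) 6,
    eventually_mul_rpow_le (show (1 / 50 : ℝ) < 1 / 10 by norm_num) 48,
    eventually_mul_rpow_le (show (1 / 10 + 1 / 3 : ℝ) < 49 / 100 by norm_num) 1000,
    eventually_mul_rpow_le (show -η < -(η / 2) by linarith) 32,
    eventually_ge_atTop 5] with n hAC h1 h2 h3 h4 h5 hn p hp hp'
  have hn' : (5 : ℝ) ≤ n := by exact_mod_cast hn
  have hn1 : (1 : ℝ) ≤ n := by linarith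
  have hpos : (0 : ℝ) < n := by linarith
  have hp0 : (0 : ℝ) < p := lt_of_lt_of_le (by positivity) hp
  have hp1 := p.2.2
  have hx : (n : ℝ) ^ (49 / 100 : ℝ) ≤ n * p := by
    calc (n : ℝ) ^ (49 / 100 : ℝ) ≤ (n : ℝ) ^ (1 + (-(1 / 2) - η / 4) : ℝ) :=
          Real.rpow_le_rpow_of_exponent_le hn1 (by linarith)
      _ = n * (n : ℝ) ^ (-(1 / 2) - η / 4 : ℝ) := by
          rw [Real.rpow_add hpos, Real.rpow_one]
      _ ≤ _ := by gcongr
  have hxp : (n : ℝ) ^ (-(η / 2)) ≤ n * p * p := by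
    calc (n : ℝ) ^ (-(η / 2)) = n * (n : ℝ) ^ (-(1 / 2) - η / 4 : ℝ)
            * (n : ℝ) ^ (-(1 / 2) - η / 4 : ℝ) := by
          rw [mul_assoc, ← Real.rpow_add hpos, ← Real.rpow_one_add' hpos.le (by linarith)]
          ring_nf
      _ ≤ _ := by gcongr
  have hxp' : (n : ℝ) * p * p ≤ (n : ℝ) ^ (1 / 50 : ℝ) := by
    calc (n : ℝ) * p * p ≤ n * (n : ℝ) ^ (-(1 / 2) + 1 / 100 : ℝ)
            * (n : ℝ) ^ (-(1 / 2) + 1 / 100 : ℝ) := by gcongr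
      _ = (n : ℝ) ^ (1 / 50 : ℝ) := by
          rw [mul_assoc, ← Real.rpow_add hpos, ← Real.rpow_one_add' hpos.le (by norm_num)]
          norm_num
  have hp3 : (p : ℝ) ≤ (n : ℝ) ^ (-(1 / 3) : ℝ) :=
    hp'.trans (Real.rpow_le_rpow_of_exponent_le hn1 (by norm_num))
  set x : ℝ := n * p with hxdef
  set y : ℝ := (n : ℝ) ^ (1 / 10 : ℝ) with hy
  set z : ℝ := (n : ℝ) ^ (1 / 3 : ℝ) with hz
  have hy1 : 1 ≤ y := Real.one_le_rpow hn1 (by norm_num)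
  have hz1 : 1 ≤ z := Real.one_le_rpow hn1 (by norm_num)
  have hyz : 1000 * (y * z) ≤ x := by
    rw [hy, hz, ← Real.rpow_add hpos]
    exact h4.trans hx
  have hyz1 : 1 ≤ y * z := one_le_mul_of_one_le_of_one_le hy1 hz1
  have hyyz : y ≤ y * z := le_mul_of_one_le_right (by linarith) hz1
  have hzyz : z ≤ y * z := le_mul_of_one_le_left (by linarith) hy1
  have hC1 := Nat.le_ceil y
  have hC2 := Nat.ceil_lt_add_one (show 0 ≤ y by linarith)
  have hN2 := Nat.ceil_lt_add_one (show 0 ≤ z by linarith)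
  have hd1 := Nat.lt_floor_add_one (x / 8)
  have hm1 : (⌊(n : ℝ) ^ (-η) / p⌋₊ : ℝ) ≤ (n : ℝ) ^ (-η) / p := Nat.floor_le (by positivity)
  have hm2 : (n : ℝ) ^ (-η) / p ≤ x / 32 := by
    rw [div_le_iff₀ hp0]
    linarith
  have hmax2 := Nat.ceil_lt_add_one (show 0 ≤ 4 * x by positivity)
  have hCN : ((⌈y⌉₊ : ℝ) + 1) * ⌈z⌉₊ ≤ (y + 2) * (z + 1) := by
    apply mul_le_mul <;> linarith
  have hmain := not_isReconstructible_le_of_first (V := Fin n) p ⌊x / 8⌋₊ ⌈4 * x⌉₊ ⌈y⌉₊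
    ⌊(n : ℝ) ^ (-η) / p⌋₊ ⌈z⌉₊ ((n : ℝ) ^ (-6 : ℝ)) (by positivity) ?_ ?_
    (fun A X t hA hX => hAC p hp0 hp3 (Fin n) A X t hA hX)
  · rw [Fintype.card_fin] at hmain
    have e1 := natCast_mul_lower_degree_le (by omega : 2 ≤ n) p hx
    have e2 := natCast_mul_upper_degree_le n p hx
    have e3 : (n : ℝ) ^ 2 * ((1 / 2) ^ ⌈y⌉₊ * (1 + p) ^ ⌈4 * x⌉₊)
        ≤ n ^ 2 * Real.exp (-(1 / 2 * y)) := by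
      refine sq_mul_upper_le n p ?_
      have : (p : ℝ) * ⌈4 * x⌉₊ ≤ p * (4 * x + 1) := by gcongr
      have : (1 : ℝ) ≤ (n : ℝ) ^ (1 / 50 : ℝ) := Real.one_le_rpow hn1 (by norm_num)
      nlinarith
    rw [show -((n : ℝ) ^ (49 / 100 : ℝ) / 8) = -(1 / 8 * (n : ℝ) ^ (49 / 100 : ℝ)) by ring]
      at e1 e2
    have b1 := (rpow_neg_six_bounds hn h1).1
    have b2 := (rpow_neg_six_bounds hn h2).2.1
    have b3 := (rpow_neg_six_bounds hn (le_refl ((n : ℝ) ^ (-6 : ℝ)))).2.2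
    refine hmain.trans ?_
    have : 1 / (5 * (n : ℝ)) = 1 / n / 5 := by field_simp
    have h0 : (0 : ℝ) ≤ 1 / n := by positivity
    linarith
  · have : (((⌈y⌉₊ + 1) * ⌈z⌉₊ + (3 * ⌈y⌉₊ + 3) : ℕ) : ℝ) ≤ ⌊x / 8⌋₊ := by
      push_cast
      linarith
    exact_mod_cast this
  · have : ((⌊(n : ℝ) ^ (-η) / p⌋₊ + ⌈y⌉₊ + 4 : ℕ) : ℝ) ≤ ⌊x / 8⌋₊ := by
      push_cast
      linarith
    exact_mod_cast this

-- Two constraints bound the range. Fitting `X` into the second neighbourhood requires `n²p³ ≥ n ^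
-- (-3η/4)` up to constants, which fixes the lower end. A vertex may have about `n²p³` neighbours
-- there, hence that many offset classes, and `n ^ ε` vertices per class must fit into `np`; so
-- `np²` has to be smaller than `n ^ (-ε)`, which the upper end provides.
set_option maxHeartbeats 800000 in
theorem exists_eventually_not_isReconstructible_le_of_second {ε : ℝ} (hε : 0 < ε)
    (hε1 : ε ≤ 1 / 400) :
    ∃ δ : ℝ, 0 < δ ∧ ∀ᶠ n : ℕ in atTop, ∀ p : unitInterval,
      (n : ℝ) ^ (-(2 / 3) - δ : ℝ) ≤ p → (p : ℝ) ≤ (n : ℝ) ^ (-(1 / 2) - ε : ℝ) →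
      (SimpleGraph.binomialRandom (Fin n) p).real {G | ¬ IsReconstructible 2 G} ≤ 1 / n := by
  obtain ⟨η, hη0, hη1, hη⟩ := exists_eventually_sum_choices_le hε
  refine ⟨η / 16, by linarith, ?_⟩
  filter_upwards [hη,
    eventually_exp_neg_le (show (0 : ℝ) < 1 / 8 by norm_num)
      (show (0 : ℝ) < 3 / 10 by norm_num) 6,
    eventually_exp_neg_le (show (0 : ℝ) < 1 / 2 by norm_num)
      (show 0 < η / 4 by linarith) 6,
    eventually_le_rpow (show 0 < η / 4 by linarith) 30,
    eventually_mul_rpow_le (show η / 4 + ε < 3 / 10 by linarith) 100000,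
    eventually_mul_rpow_le (show -(3 * η / 4) < -(3 * η / 16) by linarith) 2048,
    eventually_mul_rpow_le (show -ε < 0 by linarith) 10000,
    eventually_ge_atTop 5] with n hAC h1 h2 h3 h4 h5 h6 hn p hp hp'
  rw [Real.rpow_zero] at h6
  have hn' : (5 : ℝ) ≤ n := by exact_mod_cast hn
  have hn1 : (1 : ℝ) ≤ n := by linarith
  have hpos : (0 : ℝ) < n := by linarith
  have hp0 : (0 : ℝ) < p := lt_of_lt_of_le (by positivity) hp
  have hp1 := p.2.2
  have hx : (n : ℝ) ^ (3 / 10 : ℝ) ≤ n * p := by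
    calc (n : ℝ) ^ (3 / 10 : ℝ) ≤ (n : ℝ) ^ (1 + (-(2 / 3) - η / 16) : ℝ) :=
          Real.rpow_le_rpow_of_exponent_le hn1 (by linarith)
      _ = n * (n : ℝ) ^ (-(2 / 3) - η / 16 : ℝ) := by
          rw [Real.rpow_add hpos, Real.rpow_one]
      _ ≤ _ := by gcongr
  have hxxp : (n : ℝ) ^ (-(3 * η / 16)) ≤ (n * p) * (n * p) * p := by
    have h7 : (n : ℝ) ^ (-(3 * η / 16)) = (n : ℝ) ^ (2 : ℝ) * ((n : ℝ) ^ (-(2 / 3) - η / 16 : ℝ)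
        * ((n : ℝ) ^ (-(2 / 3) - η / 16 : ℝ) * (n : ℝ) ^ (-(2 / 3) - η / 16 : ℝ))) := by
      rw [← Real.rpow_add hpos, ← Real.rpow_add hpos, ← Real.rpow_add hpos]
      ring_nf
    rw [h7, Real.rpow_two]
    calc _ ≤ (n : ℝ) ^ 2 * (p * (p * p)) := by gcongr
      _ = _ := by ring
  have hp3 : (p : ℝ) ≤ (n : ℝ) ^ (-(1 / 3) : ℝ) :=
    hp'.trans (Real.rpow_le_rpow_of_exponent_le hn1 (by linarith))
  set x : ℝ := n * p with hxdef
  set y : ℝ := (n : ℝ) ^ (η / 4) with hy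
  set z : ℝ := (n : ℝ) ^ ε with hz
  have hy1 : 1 ≤ y := Real.one_le_rpow hn1 (by linarith)
  have hz1 : 1 ≤ z := Real.one_le_rpow hn1 hε.le
  have hyz : 100000 * (y * z) ≤ x := by
    rw [hy, hz, ← Real.rpow_add hpos]
    exact h4.trans hx
  have hyz1 : 1 ≤ y * z := one_le_mul_of_one_le_of_one_le hy1 hz1
  have hyyz : y ≤ y * z := le_mul_of_one_le_right (by linarith) hz1
  have hzyz : z ≤ y * z := le_mul_of_one_le_left (by linarith) hy1
  have hx0 : 0 < x := by linarith
  have hxpz : 10000 * (x * p * z) ≤ 1 := by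
    have h7 : x * p ≤ (n : ℝ) ^ (-ε) * (n : ℝ) ^ (-ε) := by
      calc x * p ≤ n * (n : ℝ) ^ (-(1 / 2) - ε : ℝ) * (n : ℝ) ^ (-(1 / 2) - ε : ℝ) := by
            rw [hxdef]
            gcongr
        _ = _ := by
            rw [mul_assoc, ← Real.rpow_add hpos, ← Real.rpow_one_add' hpos.le (by linarith),
              ← Real.rpow_add hpos]
            ring_nf
    have h8 : (n : ℝ) ^ (-ε) * z = 1 := by
      rw [hz, ← Real.rpow_add hpos, neg_add_cancel, Real.rpow_zero]
    calc 10000 * (x * p * z) ≤ 10000 * ((n : ℝ) ^ (-ε) * (n : ℝ) ^ (-ε) * z) := by gcongr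
      _ = 10000 * (n : ℝ) ^ (-ε) := by rw [mul_assoc, h8, mul_one]
      _ ≤ 1 := h6
  have hxp1 : x * p ≤ 1 := by nlinarith [mul_pos hx0 hp0]
  have hC1 := Nat.le_ceil y
  have hC2 := Nat.ceil_lt_add_one (show 0 ≤ y by linarith)
  have hN2 := Nat.ceil_lt_add_one (show 0 ≤ z by linarith)
  have hD0 : 0 ≤ 50 * (x * x * p) + y := by positivity
  have hD1 := Nat.le_ceil (50 * (x * x * p) + y)
  have hD2 := Nat.ceil_lt_add_one hD0
  have hd1 := Nat.lt_floor_add_one (x / 8)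
  have hm1 : (⌊(n : ℝ) ^ (-η) / p⌋₊ : ℝ) ≤ (n : ℝ) ^ (-η) / p := Nat.floor_le (by positivity)
  have hmax2 := Nat.ceil_lt_add_one (show 0 ≤ 4 * x by positivity)
  have hdmin : x / 16 + 1 ≤ ⌊x / 8⌋₊ := by linarith
  have hmain := not_isReconstructible_le_of_second (V := Fin n) p ⌊x / 8⌋₊ ⌈4 * x⌉₊ ⌈y⌉₊
    ⌈50 * (x * x * p) + y⌉₊
    ⌊(n : ℝ) ^ (-η) / p⌋₊ ⌈z⌉₊ ((n : ℝ) ^ (-6 : ℝ)) (by positivity)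
    (Nat.ceil_pos.2 (by linarith)) ?_ ?_
    (fun A X t hA hX => hAC p hp0 hp3 (Fin n) A X t hA hX)
  · rw [Fintype.card_fin] at hmain
    have e1 := natCast_mul_lower_degree_le (by omega : 2 ≤ n) p hx
    have e2 := natCast_mul_upper_degree_le n p hx
    have e3 : (n : ℝ) ^ 2 * ((1 / 2) ^ ⌈y⌉₊ * (1 + p) ^ ⌈4 * x⌉₊)
        ≤ n ^ 2 * Real.exp (-(1 / 2 * y)) := by
      refine sq_mul_upper_le n p ?_
      have : (p : ℝ) * ⌈4 * x⌉₊ ≤ p * (4 * x + 1) := by gcongr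
      nlinarith
    -- The factor `50` works because `p (5x)² = 25 x²p` is less than `2/3 * 50 x²p`; the summand `y`
    -- supplies the decay even when `x²p` is small.
    have e4 : (n : ℝ) ^ 2 * ((1 / 2) ^ ⌈50 * (x * x * p) + y⌉₊ * (1 + p) ^ ⌈4 * x⌉₊ ^ 2)
        ≤ n ^ 2 * Real.exp (-(1 / 2 * y)) := by
      refine sq_mul_upper_le n p ?_
      have h7 : (⌈4 * x⌉₊ : ℝ) ≤ 5 * x := by linarith
      have h8 : (p : ℝ) * (⌈4 * x⌉₊ ^ 2 : ℕ) ≤ p * (5 * x) ^ 2 := by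
        push_cast
        gcongr
      have h9 : 0 ≤ x * x * p := by positivity
      nlinarith
    rw [show -((n : ℝ) ^ (3 / 10 : ℝ) / 8) = -(1 / 8 * (n : ℝ) ^ (3 / 10 : ℝ)) by ring]
      at e1 e2
    have b1 := (rpow_neg_six_bounds hn h1).1
    have b2 := (rpow_neg_six_bounds hn h2).2.1
    have b3 := (rpow_neg_six_bounds hn (le_refl ((n : ℝ) ^ (-6 : ℝ)))).2.2
    refine hmain.trans ?_
    have : 1 / (5 * (n : ℝ)) = 1 / n / 5 := by field_simp
    linarith
  · have h7 : ((⌈50 * (x * x * p) + y⌉₊ : ℝ) + ⌈y⌉₊ + 3) * ⌈z⌉₊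
        ≤ (50 * (x * x * p) + 2 * y + 5) * (2 * z) := by
      apply mul_le_mul <;> linarith
    have h8 : 50 * (x * x * p) * (2 * z) ≤ x / 100 := by
      have := mul_le_mul_of_nonneg_left hxpz hx0.le
      linarith
    have : (((⌈50 * (x * x * p) + y⌉₊ + ⌈y⌉₊ + 3) * ⌈z⌉₊ + (3 * ⌈y⌉₊ + 3) : ℕ) : ℝ)
        ≤ ⌊x / 8⌋₊ := by
      push_cast
      rw [add_mul _ (5 : ℝ), add_mul _ (2 * y)] at h7
      linarith
    exact_mod_cast this
  · have hd2 : 1 ≤ ⌊x / 8⌋₊ := by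
      have : (1 : ℝ) ≤ ⌊x / 8⌋₊ := by linarith
      exact_mod_cast this
    -- With `δ = η/16`, `x²p ≥ n ^ (-3η/16)` dominates `n ^ (-η) * y = n ^ (-3η/4)`; the factor `y`
    -- is the loss from the codegree bound.
    have h7 : 2048 * ((n : ℝ) ^ (-η) * y) ≤ x * x * p := by
      rw [hy, ← Real.rpow_add hpos]
      refine le_trans (le_of_eq ?_) (h5.trans hxxp)
      ring_nf
    have h8 : (n : ℝ) ^ (-η) / p * y ≤ x * x / 2048 := by
      rw [div_mul_eq_mul_div, div_le_iff₀ hp0]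
      linarith
    have h9 : x * (100000 * y) ≤ x * x := by
      apply mul_le_mul_of_nonneg_left _ hx0.le
      linarith
    have h10 : ((⌊(n : ℝ) ^ (-η) / p⌋₊ : ℝ) + 4 * ⌈4 * x⌉₊ + 4) * ⌈y⌉₊
        ≤ ((n : ℝ) ^ (-η) / p + 20 * x) * (2 * y) := by
      apply mul_le_mul <;> linarith
    have h11 : x / 16 * (x / 16) ≤ (⌊x / 8⌋₊ : ℝ) * (⌊x / 8⌋₊ - 1) := by
      apply mul_le_mul <;> linarith
    have : (((⌊(n : ℝ) ^ (-η) / p⌋₊ + 4 * ⌈4 * x⌉₊ + 4) * ⌈y⌉₊ : ℕ) : ℝ)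
        ≤ (⌊x / 8⌋₊ * (⌊x / 8⌋₊ - 1) : ℕ) := by
      push_cast [Nat.cast_sub hd2]
      refine h10.trans (le_trans ?_ h11)
      have h12 : ((n : ℝ) ^ (-η) / p + 20 * x) * (2 * y)
          = 2 * ((n : ℝ) ^ (-η) / p * y) + 40 * (x * y) := by ring
      have h13 := mul_self_nonneg x
      rw [h12]
      linarith
    exact_mod_cast this

theorem exists_eventually_not_isReconstructible_le :
    ∃ δ : ℝ, 0 < δ ∧ ∀ᶠ n : ℕ in atTop, ∀ p : unitInterval,
      (n : ℝ) ^ (-(2 / 3 : ℝ) - δ) ≤ p →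
      (SimpleGraph.binomialRandom (Fin n) p).real {G | ¬ IsReconstructible 2 G} ≤ 1 / n := by
  obtain ⟨ε, hε, hε1, hfirst⟩ := exists_eventually_not_isReconstructible_le_of_first
  obtain ⟨δ, hδ, hsecond⟩ := exists_eventually_not_isReconstructible_le_of_second hε hε1
  refine ⟨δ, hδ, ?_⟩
  filter_upwards [hfirst, hsecond, eventually_not_isReconstructible_le_of_dense]
    with n h1 h2 h3 p hp
  rcases le_total ((n : ℝ) ^ (-(1 / 2) + 1 / 100 : ℝ)) p with h | h
  · exact h3 p h
  rcases le_total ((n : ℝ) ^ (-(1 / 2) - ε : ℝ)) p with h' | h'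
  · exact h1 p h' h
  · exact h2 p hp h'

end Regimes
end Shotgun

theorem theorem3 :
    ∃ δ : ℝ, 0 < δ ∧ ∀ p : ℕ → unitInterval,
      (∀ᶠ n : ℕ in atTop, (n : ℝ) ^ (-(2 / 3 : ℝ) - δ) ≤ (p n : ℝ)) →
        Tendsto
          (fun n : ℕ =>
            SimpleGraph.binomialRandom (Fin n) (p n)
              {G : SimpleGraph (Fin n) | Shotgun.IsReconstructible 2 G})
          atTop (𝓝 1) := by
  obtain ⟨δ, hδ, h⟩ := Shotgun.exists_eventually_not_isReconstructible_le
  refine ⟨δ, hδ, fun p hp => ?_⟩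
  -- The bound `1 / n` is uniform in `p`, so only a squeeze between `1 - 1 / n` and `1` is left.
  have hlim : Tendsto (fun n : ℕ => ENNReal.ofReal (1 - 1 / (n : ℝ))) atTop (𝓝 1) := by
    have h1 : Tendsto (fun n : ℕ => 1 - 1 / (n : ℝ)) atTop (𝓝 1) := by
      simpa using tendsto_one_div_atTop_nhds_zero_nat.const_sub (1 : ℝ)
    simpa [Function.comp_def] using (ENNReal.continuous_ofReal.tendsto 1).comp h1
  refine tendsto_of_tendsto_of_tendsto_of_le_of_le' hlim tendsto_const_nhds ?_
    (Eventually.of_forall fun n => MeasureTheory.prob_le_one)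
  filter_upwards [h, hp] with n hn hpn
  have h2 := hn (p n) hpn
  have hmeas : MeasurableSet {G : SimpleGraph (Fin n) | Shotgun.IsReconstructible 2 G} :=
    (Set.toFinite _).measurableSet
  have h3 : {G : SimpleGraph (Fin n) | ¬ Shotgun.IsReconstructible 2 G}
      = {G : SimpleGraph (Fin n) | Shotgun.IsReconstructible 2 G}ᶜ := rfl
  rw [h3, MeasureTheory.probReal_compl_eq_one_sub hmeas] at h2
  rw [← MeasureTheory.ofReal_measureReal]
  exact ENNReal.ofReal_le_ofReal (by linarith)
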